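/- Let $m\ge 3$ and $k\ge 0$ be integers. Let $\mathbb{C}_m$ be the complex Clifford algebra generated by $e_1,\dots,e_m$ with $e_j^2=-1$ and $e_je_l=-e_le_j$ for $j\ne l$. A vector $u\in\mathbb{C}^m$ is identified with the 1-vector $\sum_j u_je_j\in\mathbb{C}_m$, and $\langle u,v\rangle=\sum_j u_jv_j$. Let $\dagger$ be the Hermitian conjugation on $\mathbb{C}_m$, i.e. the conjugate-linear anti-automorphism with $e_j^\dagger=-e_j$. Let $A_n=2\pi^{n/2}/\Gamma(n/2)$, and let $C_n^{\lambda}$ be the Gegenbauer polynomials ($C^\lambda_{-1}=0$). For $x,y\in\mathbb{R}^m$ and $n\ge 0$ put $$K_{m,n}(x,y)=\tfrac{2n+m-2}{m-2}\,|x|^n|y|^n\,C_n^{\frac m2-1}(c),\qquad \mathcal{C}_{m,n}(x,y)=(|x||y|)^n\Big(C_n^{\frac m2}(c)+\frac{xy}{|x||y|}\,C_{n-1}^{\frac m2}(c)\Big),\qquad c=\frac{\langle x,y\rangle}{|x||y|}$$ (zonal spherical harmonics and zonal spherical monogenics, extended as polynomials to $x=0$ or $y=0$). For a function $F$ of $\tau$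 let $$\tilde R[F]=\frac{1}{A_mA_{m-1}}\int_{\mathbb{S}^{m-1}}\Big(\int_{\mathbb{S}^{m-2}}F(\tau)\,dS(s)\Big)dS(t),\qquad \tau=t+is,$$ where $\mathbb{S}^{m-2}$ is the unit sphere of the hyperplane orthogonal to $t$. For $0\le j\le k$ let $$\theta_{j,k,k}=\frac{(m-2)\,\Gamma(m-1)\,\Gamma\left(\frac m2+k-j-1\right)^2}{4\,(k-j)!\,\Gamma\left(\frac m2+2k-j\right)^2\,\Gamma(m+2k-2j-2)}\Big(\frac{(k!)^2}{j!}\Big)^2\frac{(2k-2j)!}{(k-j)!}.$$ These are the coefficients in the zonal expansion of the scalar average: for all $x,y\in\mathbb{R}^m$, $$\tilde R\big[\langle x,\tau\rangle^k\langle x,\tau^\dagger\rangle^k\langle y,\tau\rangle^k\langle y,\tau^\dagger\rangle^k\big]=\sum_{j=0}^{k}\theta_{j,k,k}\,|x|^{2j}K_{m,2k-2j}(x,y)\,|y|^{2j}.$$ Moreover there are real constants $\vartheta_{j,k}$ (depending only on $m$, $j$, $k$) such that for all $x,y\in\mathbb{R}^m$ $$\tilde R\big[\langle x,\tau\rangle^k\langle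 x,\tau^\dagger\rangle^k\langle y,\tau\rangle^k\langle y,\tau^\dagger\rangle^k\,\tau^\dagger\tau\big]=\sum_{j=0}^{2k}\vartheta_{j,k}\,x^{j}\,\mathcal{C}_{m,2k-j}(x,y)\,y^{j},$$ and, for $0\le j\le k$, $$\vartheta_{2j,k}=2\theta_{j,k,k}=\frac{(m-2)(k!)^4(2k-2j)!\,\Gamma(m-1)\,\Gamma\left(\frac m2+k-j-1\right)^2}{2((k-j)!)^2(j!)^2\,\Gamma\left(\frac m2+2k-j\right)^2\,\Gamma(2k-2j+m-2)},\qquad \vartheta_{2j+1,k}=-\vartheta_{2j,k}.$$ -/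

import Mathlib

open scoped TensorProduct
open MeasureTheory

noncomputable section

/-! ### The complex Clifford algebra `ℂ_m` -/

/-- The quadratic form `v ↦ -∑ v_j²` on `ℝ^m`. -/
def cliffordForm (m : ℕ) : QuadraticForm ℝ (Fin m → ℝ) :=
  QuadraticMap.weightedSumSquares ℝ (fun _ : Fin m => (-1 : ℝ))

/-- The real Clifford algebra `ℝ_m`. -/
abbrev RealClifford (m : ℕ) : Type := CliffordAlgebra (cliffordForm m)

/-- The complex Clifford algebra `ℂ_m = ℂ ⊗ ℝ_m`. -/
abbrev ComplexClifford (m : ℕ) : Type := ℂ ⊗[ℝ] RealClifford m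

/-- The generators `e_j` of `ℂ_m`. -/
def cliffordE {m : ℕ} (j : Fin m) : ComplexClifford m :=
  (1 : ℂ) ⊗ₜ[ℝ] CliffordAlgebra.ι (cliffordForm m) (Pi.single j 1)

theorem cliffordE_mul_self {m : ℕ} (j : Fin m) : cliffordE j * cliffordE j = -1 := by
  rw [cliffordE, Algebra.TensorProduct.tmul_mul_tmul, CliffordAlgebra.ι_sq_scalar]
  have h : cliffordForm m (Pi.single j 1) = -1 := by
    simp [cliffordForm, QuadraticMap.weightedSumSquares_apply, Pi.single_apply]
  rw [h, map_neg, map_one, mul_one, TensorProduct.tmul_neg, Algebra.TensorProduct.one_def]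

theorem cliffordE_anticomm {m : ℕ} {j l : Fin m} (h : j ≠ l) :
    cliffordE j * cliffordE l + cliffordE l * cliffordE j = 0 := by
  rw [cliffordE, cliffordE, Algebra.TensorProduct.tmul_mul_tmul,
    Algebra.TensorProduct.tmul_mul_tmul, ← TensorProduct.tmul_add,
    CliffordAlgebra.ι_mul_ι_add_swap]
  have h0 : QuadraticMap.polar (cliffordForm m) (Pi.single j 1) (Pi.single l 1) = 0 := by
    simp only [QuadraticMap.polar, cliffordForm, QuadraticMap.weightedSumSquares_apply,
      ← Finset.sum_sub_distrib]
    refine Finset.sum_eq_zero fun i _ => ?_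
    by_cases hj : i = j
    · subst hj; simp [h]
    · simp [hj]
  rw [h0, map_zero, TensorProduct.tmul_zero]

/-- The Hermitian conjugation `α ↦ α†` on `ℂ_m`: the conjugate-linear anti-automorphism
with `e_j† = -e_j`. -/
def hermConj {m : ℕ} : ComplexClifford m →ₗ[ℝ] ComplexClifford m :=
  TensorProduct.map Complex.conjAe.toLinearMap
    (CliffordAlgebra.reverse ∘ₗ CliffordAlgebra.involute.toLinearMap)

theorem hermConj_cliffordE {m : ℕ} (j : Fin m) :
    hermConj (cliffordE j) = -cliffordE j := by
  simp [hermConj, cliffordE, TensorProduct.tmul_neg]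

theorem hermConj_smul {m : ℕ} (c : ℂ) (a : ComplexClifford m) :
    hermConj (c • a) = starRingEnd ℂ c • hermConj a := by
  induction a using TensorProduct.induction_on with
  | zero => simp
  | tmul z b => simp [hermConj, TensorProduct.smul_tmul']
  | add a b ha hb => rw [smul_add, map_add, map_add, smul_add, ha, hb]

theorem hermConj_mul {m : ℕ} (a b : ComplexClifford m) :
    hermConj (a * b) = hermConj b * hermConj a := by
  induction a using TensorProduct.induction_on with
  | zero => simp
  | add a a' ha ha' => rw [add_mul, map_add, map_add, mul_add, ha, ha']
  | tmul z c =>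
    induction b using TensorProduct.induction_on with
    | zero => simp
    | add b b' hb hb' => rw [mul_add, map_add, map_add, add_mul, hb, hb']
    | tmul w d => simp [hermConj, mul_comm]

/-- The 1-vector `∑ u_j e_j` with complex coordinates `u`. -/
def oneVector {m : ℕ} (u : Fin m → ℂ) : ComplexClifford m := ∑ j, u j • cliffordE j

/-- The coordinates of `u†`, for a complex 1-vector with coordinates `u`. -/
def daggerVec {m : ℕ} (u : Fin m → ℂ) : Fin m → ℂ := fun j => -starRingEnd ℂ (u j)

theorem hermConj_oneVector {m : ℕ} (u : Fin m → ℂ) :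
    hermConj (oneVector u) = oneVector (daggerVec u) := by
  simp [oneVector, daggerVec, map_sum, hermConj_smul, hermConj_cliffordE]

/-- The coordinates of a real vector, regarded as complex numbers. -/
def complexCoord {m : ℕ} (x : EuclideanSpace ℝ (Fin m)) : Fin m → ℂ := fun j => (x j : ℂ)

/-- The (complex bilinear) scalar product `⟨u, v⟩ = ∑ u_j v_j` of 1-vectors. -/
def scalarProd {m : ℕ} (u v : Fin m → ℂ) : ℂ := ∑ j, u j * v j

theorem scalarProd_eq {m : ℕ} (u v : Fin m → ℂ) :
    oneVector u * oneVector v + oneVector v * oneVector u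
      = (-2 * scalarProd u v) • (1 : ComplexClifford m) := by
  have key : ∀ i j : Fin m, cliffordE i * cliffordE j + cliffordE j * cliffordE i
      = (if i = j then (-2 : ℂ) else 0) • (1 : ComplexClifford m) := by
    intro i j
    by_cases h : i = j
    · subst h
      rw [cliffordE_mul_self, if_pos rfl, neg_smul, two_smul, neg_add]
    · rw [cliffordE_anticomm h, if_neg h, zero_smul]
  have h1 : oneVector u * oneVector v + oneVector v * oneVector u
      = ∑ i, ∑ j, (u i * v j) • (cliffordE i * cliffordE j + cliffordE j * cliffordE i) := by
    simp only [oneVector, Finset.sum_mul_sum, smul_add, Finset.sum_add_distrib,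
      smul_mul_smul_comm]
    congr 1
    rw [Finset.sum_comm]
    simp only [mul_comm]
  rw [h1, scalarProd, Finset.mul_sum, Finset.sum_smul]
  refine Finset.sum_congr rfl fun i _ => ?_
  simp [key, smul_smul, mul_comm]

/-! ### Integration over the Stiefel manifold -/

/-- `HasVecIntegral μ f I`: the function `f`, with values in a complex vector space `V`, is
integrable in every coordinate, and its coordinatewise integral is `I`. -/
def HasVecIntegral {α V : Type*} [MeasurableSpace α] [AddCommGroup V] [Module ℂ V]
    (μ : Measure α) (f : α → V) (I : V) : Prop :=
  ∀ φ : Module.Dual ℂ V, Integrable (fun a => φ (f a)) μ ∧ ∫ a, φ (f a) ∂μ = φ I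

theorem HasVecIntegral.unique {α V : Type*} [MeasurableSpace α] [AddCommGroup V] [Module ℂ V]
    {μ : Measure α} {f : α → V} {I J : V} (hI : HasVecIntegral μ f I)
    (hJ : HasVecIntegral μ f J) : I = J := by
  rw [← sub_eq_zero, ← Module.forall_dual_apply_eq_zero_iff ℂ]
  intro φ
  rw [map_sub, ← (hI φ).2, ← (hJ φ).2, sub_self]

theorem hasVecIntegral_complex_iff {α : Type*} [MeasurableSpace α] {μ : Measure α} {f : α → ℂ}
    {I : ℂ} : HasVecIntegral μ f I ↔ Integrable f μ ∧ ∫ a, f a ∂μ = I := by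
  constructor
  · intro h
    exact h LinearMap.id
  · rintro ⟨h, rfl⟩ φ
    have hφ : ∀ z : ℂ, φ z = φ 1 * z := fun z => by
      conv_lhs => rw [← mul_one z, ← smul_eq_mul, map_smul, smul_eq_mul, mul_comm]
    have hf : (fun a => φ (f a)) = fun a => φ 1 * f a := funext fun a => hφ (f a)
    refine ⟨?_, ?_⟩
    · rw [hf]
      exact h.const_mul _
    · rw [hφ (∫ a, f a ∂μ), ← integral_const_mul, hf]

/-- The unit sphere of a real inner product space. -/
abbrev UnitSphere (E : Type*) [NormedAddCommGroup E] : Type _ := Metric.sphere (0 : E) 1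

/-- The surface measure on the unit sphere of a Euclidean space. -/
def surfaceMeasure (E : Type*) [NormedAddCommGroup E] [InnerProductSpace ℝ E]
    [FiniteDimensional ℝ E] [MeasurableSpace E] [BorelSpace E] : Measure (UnitSphere E) :=
  (volume : Measure E).toSphere

/-- The area `A_m = 2 π^{m/2} / Γ(m/2)` of the unit sphere in `ℝ^m`. -/
def sphereArea (m : ℕ) : ℝ := 2 * Real.pi ^ ((m : ℝ) / 2) / Real.Gamma ((m : ℝ) / 2)

/-- The orthogonal complement of `t`. -/
abbrev perp {m : ℕ} (t : UnitSphere (EuclideanSpace ℝ (Fin m))) :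
    Submodule ℝ (EuclideanSpace ℝ (Fin m)) :=
  (Submodule.span ℝ {(t : EuclideanSpace ℝ (Fin m))})ᗮ

/-- The coordinates of `τ = t + i s`, where `t` is a unit vector and `s` is a unit vector
orthogonal to `t`. -/
def tauVec {m : ℕ} (t : UnitSphere (EuclideanSpace ℝ (Fin m))) (s : UnitSphere (perp t)) :
    Fin m → ℂ :=
  complexCoord (t : EuclideanSpace ℝ (Fin m)) +
    Complex.I • complexCoord (((s : perp t) : EuclideanSpace ℝ (Fin m)))

/-- `HasDualRadon F I`: the dual Radon transform
`(1 / (A_m A_{m-1})) ∫_{t ∈ S^{m-1}} (∫_{s ∈ S^{m-2}, s ⟂ t} F(t + i s) dS(s)) dS(t)`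
of the function `F` exists and equals `I`. -/
def HasDualRadon {m : ℕ} {V : Type*} [AddCommGroup V] [Module ℂ V]
    (F : (Fin m → ℂ) → V) (I : V) : Prop :=
  ∃ (G : UnitSphere (EuclideanSpace ℝ (Fin m)) → V) (J : V),
    (∀ t, HasVecIntegral (surfaceMeasure (perp t)) (fun s => F (tauVec t s)) (G t)) ∧
    HasVecIntegral (surfaceMeasure (EuclideanSpace ℝ (Fin m))) G J ∧
    I = ((1 / (sphereArea m * sphereArea (m - 1)) : ℝ) : ℂ) • J

/-! ### Zonal spherical harmonics and zonal spherical monogenics -/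

/-- The Gegenbauer polynomial `C_n^lam(t)`, that is
`∑_{i ≤ n/2} (-1)^i (lam)_{n-i} / (i! (n-2i)!) (2t)^{n-2i}` with Pochhammer symbols `(lam)_{n-i}`. -/
def gegenbauer (lam : ℝ) (n : ℕ) (t : ℝ) : ℝ :=
  ∑ i ∈ Finset.range (n / 2 + 1),
    (-1) ^ i * (ascPochhammer ℝ (n - i)).eval lam
      / ((i.factorial : ℝ) * ((n - 2 * i).factorial : ℝ)) * (2 * t) ^ (n - 2 * i)

/-- The cosine `t = ⟨x, y⟩ / (|x| |y|)`; the value at `x = 0` or `y = 0` plays no role below. -/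
def cosAngle {m : ℕ} (x y : EuclideanSpace ℝ (Fin m)) : ℝ := inner ℝ x y / (‖x‖ * ‖y‖)

/-- The zonal spherical harmonic
`K_{m,k}(x, y) = (2k+m-2)/(m-2) |x|^k |y|^k C_k^{m/2-1}(t)`. -/
def zonalHarmonic (m k : ℕ) (x y : EuclideanSpace ℝ (Fin m)) : ℝ :=
  (2 * k + m - 2) / (m - 2) * ‖x‖ ^ k * ‖y‖ ^ k * gegenbauer ((m : ℝ) / 2 - 1) k (cosAngle x y)

/-- The real vector `x` as a 1-vector of `ℂ_m`. -/
def vecVar {m : ℕ} (x : EuclideanSpace ℝ (Fin m)) : ComplexClifford m :=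
  oneVector (complexCoord x)

/-- The zonal spherical monogenic
`C_{m,k}(x, y) = (|x||y|)^k (C_k^{m/2}(t) + (x y / (|x||y|)) C_{k-1}^{m/2}(t))`, with `C_{-1} = 0`.
For `x = 0` or `y = 0` the formula gives `1` if `k = 0` and `0` if `k > 0`, which is the value of
the polynomial `C_{m,k}`. -/
def zonalMonogenic (m k : ℕ) (x y : EuclideanSpace ℝ (Fin m)) : ComplexClifford m :=
  (‖x‖ * ‖y‖) ^ k •
    (gegenbauer ((m : ℝ) / 2) k (cosAngle x y) • (1 : ComplexClifford m) +
      ((if k = 0 then 0 else gegenbauer ((m : ℝ) / 2) (k - 1) (cosAngle x y)) / (‖x‖ * ‖y‖)) •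
        (vecVar x * vecVar y))

/-- The coefficients `θ_{n,k,l}` (for `n ≤ k` and `n ≤ l`). -/
def thetaCoeff (m n k l : ℕ) : ℝ :=
  (-1) ^ (k + l) *
    (Real.Gamma ((m : ℝ) - 1) * Real.Gamma ((m : ℝ) / 2 + k - n - 1)
        * Real.Gamma ((m : ℝ) / 2 + l - n - 1) * ((m : ℝ) - 2)
      / (4 * ((l - n).factorial : ℝ) * Real.Gamma ((m : ℝ) / 2 + k + l - n) ^ 2
        * Real.Gamma ((m : ℝ) + k + l - 2 * n - 2)))
    * ((k.factorial : ℝ) * (l.factorial : ℝ) / (n.factorial : ℝ)) ^ 2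
    * (((k + l - 2 * n).factorial : ℝ) / ((k - n).factorial : ℝ))

end

/-! Let P be the orthogonal projection onto the plane spanned by an orthonormal pair (t, s). Since
τ† = -conj τ, the product ⟨x, τ⟩⟨x, τ†⟩ equals -|P x|², and |P x|² is `planeForm x x`. The scalar
average is therefore the mean of |P x|^(2k) |P y|^(2k) over orthonormal pairs (`stiefelMean`). It is
computed by harmonic analysis in x, with y a fixed unit vector and with independent exponents k and
l.

Three facts determine the mean. It is invariant under isometries fixing y, hence a zonal polynomial,
even in ⟨x, y⟩ and |x| (`isZonal_stiefelMean`). Its Laplacian lowers k: since P x lives in a plane,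
Δ|P x|^(2k) = 4k²|P x|^(2k-2) (`hasHalfLaplacian_stiefelMean`). At x = y it is the mean of |P
y|^(2k+2l), a quotient of Gamma values (`stiefelMean_planeForm_pow`). A zonal harmonic polynomial
that vanishes at y is zero (`IsZonal.eq_zero`), so induction on k reduces the expansion to two
identities for its coefficients `wellPoisedTerm`: a ratio in k that matches the Laplacians, and the
evaluation at y, a terminating well-poised hypergeometric sum that is summed by creative telescoping
(`sum_wellPoisedTerm`).

For the Clifford-valued average, τ†τ = 2 - 2i ts. The product ts is odd in s while the scalar factor
is even, so the average is twice the scalar one. A contiguity relation of Gegenbauer polynomials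
gives C_n - x C_(n-1) y = K_n for n ≥ 2 (`zonalMonogenic_sub`). Each zonal harmonic thus splits into
two consecutive monogenic terms with opposite coefficients. -/

noncomputable section

/-! ### The surface measure -/

section SurfaceMeasure

variable {E F : Type*} [NormedAddCommGroup E] [InnerProductSpace ℝ E]
  [NormedAddCommGroup F] [InnerProductSpace ℝ F]

/-- The map between unit spheres that is induced by a linear isometry. -/
def sphereMap (e : E ≃ₗᵢ[ℝ] F) (s : UnitSphere E) : UnitSphere F :=
  ⟨e s, by simp⟩

theorem continuous_sphereMap (e : E ≃ₗᵢ[ℝ] F) : Continuous (sphereMap e) :=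
  Continuous.subtype_mk (e.continuous.comp continuous_subtype_val) _

variable [FiniteDimensional ℝ E] [MeasurableSpace E] [BorelSpace E]
  [FiniteDimensional ℝ F] [MeasurableSpace F] [BorelSpace F]

/-- The surface measure of a set is the dimension times the volume of the cone over it, and an
isometry carries cones to cones and preserves volume. -/
theorem measurePreserving_sphereMap (e : E ≃ₗᵢ[ℝ] F) :
    MeasurePreserving (sphereMap e) (surfaceMeasure E) (surfaceMeasure F) := by
  have hm : Measurable (sphereMap e) := (continuous_sphereMap e).measurable
  refine ⟨hm, ?_⟩
  ext A hA
  rw [Measure.map_apply hm hA, surfaceMeasure, surfaceMeasure,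
    Measure.toSphere_apply' _ (hm hA), Measure.toSphere_apply' _ hA,
    e.toLinearEquiv.finrank_eq]
  congr 1
  rw [← e.symm.measurePreserving.measure_preimage_equiv (f := e.symm.toMeasurableEquiv)]
  congr 1
  ext v
  simp only [Set.mem_preimage, Set.mem_smul, Set.mem_image]
  constructor
  · rintro ⟨r, hr, _, ⟨s, hs, rfl⟩, h⟩
    refine ⟨r, hr, _, ⟨_, hs, rfl⟩, ?_⟩
    have h' := congrArg e h
    simpa [sphereMap] using h'
  · rintro ⟨r, hr, _, ⟨s, hs, rfl⟩, h⟩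
    refine ⟨r, hr, _, ⟨sphereMap e.symm s, ?_, rfl⟩, ?_⟩
    · have : sphereMap e (sphereMap e.symm s) = s := by ext; simp [sphereMap]
      rwa [this]
    · have h' := congrArg e.symm h
      simpa [sphereMap] using h'

theorem integral_sphereMap (e : E ≃ₗᵢ[ℝ] F) {G : Type*} [NormedAddCommGroup G] [NormedSpace ℝ G]
    {f : UnitSphere F → G} (hf : Continuous f) :
    ∫ s, f (sphereMap e s) ∂surfaceMeasure E = ∫ s, f s ∂surfaceMeasure F := by
  rw [← (measurePreserving_sphereMap e).map_eq,
    integral_map (measurePreserving_sphereMap e).measurable.aemeasurable]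
  rw [(measurePreserving_sphereMap e).map_eq]
  exact hf.aestronglyMeasurable

instance isFiniteMeasure_surfaceMeasure : IsFiniteMeasure (surfaceMeasure E) := by
  unfold surfaceMeasure; infer_instance

theorem integrable_of_continuous_sphere {G : Type*} [NormedAddCommGroup G]
    {f : UnitSphere E → G} (hf : Continuous f) : Integrable f (surfaceMeasure E) :=
  hf.integrable_of_hasCompactSupport (HasCompactSupport.of_compactSpace f)

theorem surfaceMeasure_real_univ [Nontrivial E] :
    (surfaceMeasure E).real Set.univ = sphereArea (Module.finrank ℝ E) := by
  have hn : (0 : ℝ) < Module.finrank ℝ E := by exact_mod_cast Module.finrank_pos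
  have hG : 0 < Real.Gamma ((Module.finrank ℝ E : ℝ) / 2) := Real.Gamma_pos_of_pos (by positivity)
  rw [surfaceMeasure, Measure.toSphere_real_apply_univ, Measure.real,
    InnerProductSpace.volume_ball, ENNReal.ofReal_one, one_pow, one_mul, sphereArea,
    Real.Gamma_add_one (by positivity), Real.sqrt_eq_rpow, ← Real.rpow_mul_natCast Real.pi_pos.le,
    ENNReal.toReal_ofReal (by positivity)]
  rw [show (1 / 2 : ℝ) * (Module.finrank ℝ E : ℝ) = (Module.finrank ℝ E : ℝ) / 2 by ring]
  field_simp

end SurfaceMeasure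

theorem sphereArea_pos {n : ℕ} (hn : 0 < n) : 0 < sphereArea n := by
  have hn' : (0 : ℝ) < n := by exact_mod_cast hn
  have := Real.Gamma_pos_of_pos (half_pos hn')
  have := Real.pi_pos
  unfold sphereArea
  positivity

/-! ### Averages over pairs of orthogonal unit vectors. -/

section Stiefel

variable {m : ℕ}

theorem mem_perp_iff {t : UnitSphere (EuclideanSpace ℝ (Fin m))} {v : EuclideanSpace ℝ (Fin m)} :
    v ∈ perp t ↔ inner ℝ (t : EuclideanSpace ℝ (Fin m)) v = 0 :=
  Submodule.mem_orthogonal_singleton_iff_inner_right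

/-- A linear isometry `g` maps the orthogonal complement of `t` onto that of `g t`. -/
def perpMap (g : EuclideanSpace ℝ (Fin m) ≃ₗᵢ[ℝ] EuclideanSpace ℝ (Fin m))
    {t t' : UnitSphere (EuclideanSpace ℝ (Fin m))} (h : g t = t') : perp t ≃ₗᵢ[ℝ] perp t' where
  toLinearEquiv := g.toLinearEquiv.ofSubmodules (perp t) (perp t') (by
    ext v
    constructor
    · rintro ⟨w, hw, rfl⟩
      rw [SetLike.mem_coe, mem_perp_iff] at hw
      rw [mem_perp_iff, ← h, ← hw]
      exact g.inner_map_map _ _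
    · intro hv
      refine ⟨g.symm v, ?_, g.apply_symm_apply v⟩
      rw [mem_perp_iff, ← h] at hv
      rw [SetLike.mem_coe, mem_perp_iff, ← hv, ← g.inner_map_map, g.apply_symm_apply])
  norm_map' v := g.norm_map v

/-- The integral of `φ(t, ·)` over the unit sphere of the hyperplane orthogonal to `t`. -/
def innerIntegral (φ : C(EuclideanSpace ℝ (Fin m) × EuclideanSpace ℝ (Fin m), ℝ))
    (t : UnitSphere (EuclideanSpace ℝ (Fin m))) : ℝ :=
  ∫ s : UnitSphere (perp t), φ (t, (s : perp t)) ∂surfaceMeasure (perp t)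

theorem continuous_coe_perp (t : UnitSphere (EuclideanSpace ℝ (Fin m))) :
    Continuous fun s : UnitSphere (perp t) => ((s : perp t) : EuclideanSpace ℝ (Fin m)) :=
  continuous_subtype_val.comp continuous_subtype_val

theorem integrable_innerIntegral (φ : C(EuclideanSpace ℝ (Fin m) × EuclideanSpace ℝ (Fin m), ℝ))
    (t : UnitSphere (EuclideanSpace ℝ (Fin m))) :
    Integrable (fun s : UnitSphere (perp t) => φ (t, (s : perp t))) (surfaceMeasure (perp t)) :=
  integrable_of_continuous_sphere
    (φ.continuous.comp (continuous_const.prodMk (continuous_coe_perp t)))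

/-- This moves an integral over the sphere orthogonal to `t'` to the sphere orthogonal to `t`. It
serves both the continuity in `t'` and the invariance of the mean. -/
theorem innerIntegral_eq_of_isometry
    (φ : C(EuclideanSpace ℝ (Fin m) × EuclideanSpace ℝ (Fin m), ℝ))
    (g : EuclideanSpace ℝ (Fin m) ≃ₗᵢ[ℝ] EuclideanSpace ℝ (Fin m))
    {t t' : UnitSphere (EuclideanSpace ℝ (Fin m))} (h : g t = t') :
    innerIntegral φ t' =
      ∫ s : UnitSphere (perp t), φ (t', g (s : perp t)) ∂surfaceMeasure (perp t) := by
  rw [innerIntegral, ← integral_sphereMap (perpMap g h)]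
  · rfl
  · exact φ.continuous.comp (continuous_const.prodMk (continuous_coe_perp t'))

/-- The domain of integration varies with t. Reflections carrying a fixed unit vector `e` to t pull
every integral back to one sphere, where dominated convergence applies. -/
theorem continuous_innerIntegral
    (φ : C(EuclideanSpace ℝ (Fin m) × EuclideanSpace ℝ (Fin m), ℝ)) :
    Continuous (innerIntegral φ) := by
  rw [continuous_iff_continuousAt]
  intro t₀
  -- The reflection along `e - t` depends continuously on t only where `t ≠ e`; the antipode of `t₀`
  -- stays away from all t near `t₀`.
  set e : UnitSphere (EuclideanSpace ℝ (Fin m)) := -t₀ with he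
  let g (t : UnitSphere (EuclideanSpace ℝ (Fin m))) :=
    (Submodule.span ℝ {((e : EuclideanSpace ℝ (Fin m)) - t)})ᗮ.reflection
  have hg : ∀ t, g t e = t := fun t => Submodule.reflection_sub (by simp)
  have hne : ((e : EuclideanSpace ℝ (Fin m)) - t₀) ≠ 0 := by
    intro h
    have h1 : ‖(t₀ : EuclideanSpace ℝ (Fin m))‖ = 1 := by simp
    have h2 : (t₀ : EuclideanSpace ℝ (Fin m)) = 0 := by
      have h3 : -(t₀ : EuclideanSpace ℝ (Fin m)) - t₀ = 0 := h
      have h4 : (2 : ℝ) • (t₀ : EuclideanSpace ℝ (Fin m)) = -(-t₀ - t₀) := by module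
      rw [h3] at h4
      simpa using h4
    rw [h2] at h1; simp at h1
  obtain ⟨C, hC⟩ := ((isCompact_closedBall (0 : EuclideanSpace ℝ (Fin m)) 1).prod
    (isCompact_closedBall (0 : EuclideanSpace ℝ (Fin m)) 1)).exists_bound_of_continuousOn
      φ.continuous.continuousOn
  have hfun : innerIntegral φ = fun t : UnitSphere (EuclideanSpace ℝ (Fin m)) =>
      ∫ s : UnitSphere (perp e), φ (t, g t (s : perp e)) ∂surfaceMeasure (perp e) :=
    funext fun t => innerIntegral_eq_of_isometry φ (g t) (hg t)
  rw [hfun]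
  refine continuousAt_of_dominated (bound := fun _ => C) ?_ ?_ (integrable_const C) ?_
  · refine Filter.Eventually.of_forall fun t => Continuous.aestronglyMeasurable ?_
    exact φ.continuous.comp (continuous_const.prodMk ((g t).continuous.comp (continuous_coe_perp e)))
  · refine Filter.Eventually.of_forall fun t => Filter.Eventually.of_forall fun s => hC _ ?_
    have hs : ‖((s : perp e) : EuclideanSpace ℝ (Fin m))‖ = 1 := norm_eq_of_mem_sphere s
    refine ⟨?_, ?_⟩ <;> simp [hs]
  · refine Filter.Eventually.of_forall fun s => φ.continuous.continuousAt.comp ?_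
    refine continuous_subtype_val.continuousAt.prodMk ?_
    have hf : (fun t : UnitSphere (EuclideanSpace ℝ (Fin m)) =>
        g t (((s : perp e) : EuclideanSpace ℝ (Fin m)))) =
        fun t : UnitSphere (EuclideanSpace ℝ (Fin m)) =>
        -((2 : ℕ) • (inner ℝ ((e : EuclideanSpace ℝ (Fin m)) - t)
          ((s : perp e) : EuclideanSpace ℝ (Fin m)) / ‖(e : EuclideanSpace ℝ (Fin m)) - t‖ ^ 2) • ((e : EuclideanSpace ℝ (Fin m)) - t)
            - ((s : perp e) : EuclideanSpace ℝ (Fin m))) := by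
      funext t
      simp only [g, Submodule.reflection_orthogonal_apply, Submodule.reflection_singleton_apply]
      rfl
    rw [hf]
    have hc : ContinuousAt (fun t : UnitSphere (EuclideanSpace ℝ (Fin m)) =>
      (e : EuclideanSpace ℝ (Fin m)) - t) t₀ := by fun_prop
    have hn : ‖(e : EuclideanSpace ℝ (Fin m)) - t₀‖ ^ 2 ≠ 0 := by
      simpa using hne
    fun_prop (disch := assumption)

/-- The mean value of `φ(t, s)` over all pairs `(t, s)` of orthogonal unit vectors. -/
def stiefelMean : C(EuclideanSpace ℝ (Fin m) × EuclideanSpace ℝ (Fin m), ℝ) →ₗ[ℝ] ℝ where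
  toFun φ := 1 / (sphereArea m * sphereArea (m - 1)) *
    ∫ t, innerIntegral φ t ∂surfaceMeasure (EuclideanSpace ℝ (Fin m))
  map_add' φ ψ := by
    have h : innerIntegral (φ + ψ) = fun t => innerIntegral φ t + innerIntegral ψ t := by
      funext t
      exact integral_add (integrable_innerIntegral φ t) (integrable_innerIntegral ψ t)
    rw [h, integral_add, mul_add]
    · exact integrable_of_continuous_sphere (continuous_innerIntegral φ)
    · exact integrable_of_continuous_sphere (continuous_innerIntegral ψ)
  map_smul' c φ := by
    have h : innerIntegral (c • φ) = fun t => c * innerIntegral φ t := by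
      funext t
      exact integral_const_mul c _
    rw [h, integral_const_mul]
    simp only [RingHom.id_apply, smul_eq_mul]
    ring

theorem stiefelMean_apply (φ : C(EuclideanSpace ℝ (Fin m) × EuclideanSpace ℝ (Fin m), ℝ)) :
    stiefelMean φ = 1 / (sphereArea m * sphereArea (m - 1)) *
      ∫ t, innerIntegral φ t ∂surfaceMeasure (EuclideanSpace ℝ (Fin m)) := rfl

theorem stiefelMean_congr {φ ψ : C(EuclideanSpace ℝ (Fin m) × EuclideanSpace ℝ (Fin m), ℝ)}
    (h : ∀ t s : EuclideanSpace ℝ (Fin m), ‖t‖ = 1 → ‖s‖ = 1 → inner ℝ t s = 0 →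
      φ (t, s) = ψ (t, s)) : stiefelMean φ = stiefelMean ψ := by
  have : innerIntegral φ = innerIntegral ψ := by
    funext t
    refine integral_congr_ae (Filter.Eventually.of_forall fun s => h _ _ (by simp) ?_ ?_)
    · exact norm_eq_of_mem_sphere s
    · exact mem_perp_iff.1 (s : perp t).2
  rw [stiefelMean_apply, stiefelMean_apply, this]

theorem stiefelMean_isometry (φ : C(EuclideanSpace ℝ (Fin m) × EuclideanSpace ℝ (Fin m), ℝ))
    (g : EuclideanSpace ℝ (Fin m) ≃ₗᵢ[ℝ] EuclideanSpace ℝ (Fin m)) :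
    stiefelMean (φ.comp ⟨Prod.map g g, g.continuous.prodMap g.continuous⟩) = stiefelMean φ := by
  rw [stiefelMean_apply, stiefelMean_apply, ← integral_sphereMap g (continuous_innerIntegral φ)]
  congr 2
  funext t
  exact (innerIntegral_eq_of_isometry φ g (t' := sphereMap g t) rfl).symm

theorem finrank_perp (hm : 2 ≤ m) (t : UnitSphere (EuclideanSpace ℝ (Fin m))) :
    Module.finrank ℝ (perp t) = m - 1 := by
  have : Fact (Module.finrank ℝ (EuclideanSpace ℝ (Fin m)) = (m - 1) + 1) :=
    ⟨by rw [finrank_euclideanSpace_fin]; omega⟩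
  exact Submodule.finrank_orthogonal_span_singleton (ne_zero_of_mem_unit_sphere t)

theorem stiefelMean_one (hm : 2 ≤ m) : stiefelMean (m := m) 1 = 1 := by
  have hin : innerIntegral (m := m) 1 = fun _ => sphereArea (m - 1) := by
    funext t
    have : Nontrivial (perp t) := Module.nontrivial_of_finrank_pos (R := ℝ)
      (by rw [finrank_perp hm]; omega)
    simp only [innerIntegral, ContinuousMap.one_apply, integral_const, smul_eq_mul, mul_one]
    rw [surfaceMeasure_real_univ, finrank_perp hm]
  have : Nontrivial (EuclideanSpace ℝ (Fin m)) := Module.nontrivial_of_finrank_pos (R := ℝ)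
    (by rw [finrank_euclideanSpace_fin]; omega)
  rw [stiefelMean_apply, hin, integral_const, surfaceMeasure_real_univ, finrank_euclideanSpace_fin, smul_eq_mul]
  have h1 := (sphereArea_pos (n := m) (by omega)).ne'
  have h2 := (sphereArea_pos (n := m - 1) (by omega)).ne'
  field_simp

end Stiefel

/-! ### The Laplacian of polynomial functions -/

section Laplacian

open Polynomial

theorem coeff_two_mul {S : Type*} [CommRing S] (p q : S[X]) :
    (p * q).coeff 2 = p.coeff 0 * q.coeff 2 + p.coeff 1 * q.coeff 1 + p.coeff 2 * q.coeff 0 := by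
  rw [coeff_mul, Finset.Nat.sum_antidiagonal_eq_sum_range_succ_mk]
  simp [Finset.sum_range_succ]

theorem coeff_zero_pow' {S : Type*} [CommRing S] (p : S[X]) (k : ℕ) :
    (p ^ k).coeff 0 = p.coeff 0 ^ k := by
  simp [coeff_zero_eq_eval_zero]

theorem coeff_one_pow' {S : Type*} [CommRing S] (p : S[X]) (k : ℕ) :
    (p ^ k).coeff 1 = k * p.coeff 0 ^ (k - 1) * p.coeff 1 := by
  induction k with
  | zero => simp [coeff_one]
  | succ k ih =>
    rw [pow_succ, mul_coeff_one, ih, coeff_zero_pow']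
    rcases k with _ | k
    · simp
    · simp only [Nat.add_sub_cancel]
      push_cast
      ring

/-- The ring is arbitrary because the formula is needed over ℝ and over the ring of continuous
functions of (t, s). Truncated exponents are harmless: their numerical factors vanish. -/
theorem coeff_two_pow {S : Type*} [CommRing S] (p : S[X]) (k : ℕ) :
    (p ^ k).coeff 2 = k * p.coeff 0 ^ (k - 1) * p.coeff 2
      + k.choose 2 * p.coeff 0 ^ (k - 2) * p.coeff 1 ^ 2 := by
  induction k with
  | zero => simp [coeff_one]
  | succ k ih =>
    rw [pow_succ, coeff_two_mul, ih, coeff_zero_pow', coeff_one_pow', Nat.choose_succ_succ' k 1,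
      Nat.choose_one_right]
    rcases k with _ | _ | k
    · simp
    · simp
      ring
    · simp only [Nat.add_sub_cancel, show k + 1 + 1 + 1 - 2 = k + 1 by omega,
        show k + 1 + 1 - 2 = k by omega]
      push_cast
      ring

/-- The polynomial obtained by applying a linear functional to every coefficient. -/
def functionalPoly {R : Type*} [CommRing R] [Algebra ℝ R] (l : R →ₗ[ℝ] ℝ) (P : R[X]) : ℝ[X] :=
  ∑ j ∈ Finset.range (P.natDegree + 1), monomial j (l (P.coeff j))

/-- Together with `coeff_functionalPoly`, this lets the extraction of a coefficient commute with the
mean, so no differentiation under the integral sign is needed. -/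
theorem eval_functionalPoly {R : Type*} [CommRing R] [Algebra ℝ R] (l : R →ₗ[ℝ] ℝ) (P : R[X])
    (r : ℝ) : (functionalPoly l P).eval r = l (P.eval (algebraMap ℝ R r)) := by
  rw [functionalPoly, eval_finsetSum, eval_eq_sum_range, map_sum]
  refine Finset.sum_congr rfl fun j _ => ?_
  rw [eval_monomial, ← map_pow, mul_comm (P.coeff j), ← Algebra.smul_def, map_smul, smul_eq_mul,
    mul_comm]

theorem coeff_functionalPoly {R : Type*} [CommRing R] [Algebra ℝ R] (l : R →ₗ[ℝ] ℝ) (P : R[X])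
    (n : ℕ) : (functionalPoly l P).coeff n = l (P.coeff n) := by
  simp only [functionalPoly, finsetSum_coeff, coeff_monomial, Finset.sum_ite_eq',
    Finset.mem_range]
  split_ifs with h
  · rfl
  · rw [coeff_eq_zero_of_natDegree_lt (by omega), map_zero]

variable {m : ℕ}

/-- The function `f` is polynomial along all coordinate directions, and `g` is half its
Laplacian. -/
def HasHalfLaplacian (f g : EuclideanSpace ℝ (Fin m) → ℝ) : Prop :=
  ∀ x, ∃ p : Fin m → ℝ[X],
    (∀ i r, f (x + r • EuclideanSpace.single i 1) = (p i).eval r) ∧ ∑ i, (p i).coeff 2 = g x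

theorem HasHalfLaplacian.unique {f g g' : EuclideanSpace ℝ (Fin m) → ℝ}
    (h : HasHalfLaplacian f g) (h' : HasHalfLaplacian f g') : g = g' := by
  funext x
  obtain ⟨p, hp, hpg⟩ := h x
  obtain ⟨q, hq, hqg⟩ := h' x
  rw [← hpg, ← hqg]
  refine Finset.sum_congr rfl fun i _ => ?_
  rw [Polynomial.funext fun r => (hp i r).symm.trans (hq i r)]

theorem HasHalfLaplacian.add {f g f' g' : EuclideanSpace ℝ (Fin m) → ℝ}
    (h : HasHalfLaplacian f g) (h' : HasHalfLaplacian f' g') :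
    HasHalfLaplacian (fun x => f x + f' x) (fun x => g x + g' x) := by
  intro x
  obtain ⟨p, hp, hpg⟩ := h x
  obtain ⟨q, hq, hqg⟩ := h' x
  refine ⟨fun i => p i + q i, fun i r => ?_, ?_⟩
  · simp only [hp, hq, eval_add]
  · simp only [coeff_add, Finset.sum_add_distrib, hpg, hqg]

theorem HasHalfLaplacian.const_mul {f g : EuclideanSpace ℝ (Fin m) → ℝ} (c : ℝ)
    (h : HasHalfLaplacian f g) : HasHalfLaplacian (fun x => c * f x) (fun x => c * g x) := by
  intro x
  obtain ⟨p, hp, hpg⟩ := h x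
  refine ⟨fun i => C c * p i, fun i r => ?_, ?_⟩
  · simp only [hp, eval_mul, eval_C]
  · simp only [coeff_C_mul, ← Finset.mul_sum, hpg]

theorem HasHalfLaplacian.sub {f g f' g' : EuclideanSpace ℝ (Fin m) → ℝ}
    (h : HasHalfLaplacian f g) (h' : HasHalfLaplacian f' g') :
    HasHalfLaplacian (fun x => f x - f' x) (fun x => g x - g' x) := by
  simpa only [neg_one_mul, ← sub_eq_add_neg] using h.add (h'.const_mul (-1))

theorem HasHalfLaplacian.sum {ι : Type*} (s : Finset ι)
    {f g : ι → EuclideanSpace ℝ (Fin m) → ℝ} (h : ∀ j ∈ s, HasHalfLaplacian (f j) (g j)) :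
    HasHalfLaplacian (fun x => ∑ j ∈ s, f j x) (fun x => ∑ j ∈ s, g j x) := by
  classical
  induction s using Finset.induction_on with
  | empty => exact fun x => ⟨fun _ => 0, by simp, by simp⟩
  | insert a s ha ih =>
    simp only [Finset.sum_insert ha]
    exact (h a (by simp)).add (ih fun j hj => h j (by simp [hj]))

theorem natCast_mul_pow_sub_one (a : ℝ) (n : ℕ) : n * a ^ (n - 1) * a = n * a ^ n := by
  rcases n with _ | n
  · simp
  · rw [Nat.add_sub_cancel, pow_succ]; ring

theorem choose_two_mul_pow_sub_two (a : ℝ) (n : ℕ) :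
    2 * (n.choose 2 : ℝ) * a ^ (n - 2) * a = n * (n - 1) * a ^ (n - 1) := by
  rcases n with _ | _ | n
  · simp
  · simp
  · rw [Nat.cast_choose_two, show n + 1 + 1 - 2 = n by omega, show n + 1 + 1 - 1 = n + 1 by omega,
      pow_succ]
    push_cast
    ring

/-- Along `x + r e_i` the inner product with y is affine in r and `‖x‖ ^ 2` is monic quadratic. The
r² coefficients are summed using ∑ y_i² = 1, ∑ x_i² = ‖x‖² and ∑ x_i y_i = ⟨x, y⟩. -/
theorem hasHalfLaplacian_monomial {y : EuclideanSpace ℝ (Fin m)} (hy : ‖y‖ = 1) (p b : ℕ) :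
    HasHalfLaplacian (fun x => inner ℝ x y ^ p * (‖x‖ ^ 2) ^ b) (fun x =>
      p.choose 2 * (inner ℝ x y ^ (p - 2) * (‖x‖ ^ 2) ^ b) +
        b * (2 * p + m + 2 * b - 2) * (inner ℝ x y ^ p * (‖x‖ ^ 2) ^ (b - 1))) := by
  intro x
  refine ⟨fun i => (C (inner ℝ x y) + C (y i) * X) ^ p *
    (C (‖x‖ ^ 2) + C (2 * x i) * X + X ^ 2) ^ b, fun i r => ?_, ?_⟩
  · simp only [eval_mul, eval_pow, eval_add, eval_C, eval_X]
    rw [inner_add_left, inner_smul_left, norm_add_sq_real, inner_smul_right, norm_smul]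
    simp [EuclideanSpace.inner_single_left, EuclideanSpace.inner_single_right]
    ring
  · have hyy : ∑ i, y i ^ 2 = 1 := by
      have := EuclideanSpace.real_norm_sq_eq y
      rw [hy] at this; simpa using this.symm
    have hxx : ∑ i, x i ^ 2 = ‖x‖ ^ 2 := (EuclideanSpace.real_norm_sq_eq x).symm
    have hxy : ∑ i, x i * y i = inner ℝ x y := by
      rw [PiLp.inner_apply]; simp [mul_comm]
    simp only [coeff_two_mul, coeff_two_pow, coeff_one_pow', coeff_zero_pow']
    generalize ‖x‖ ^ 2 = N at *
    generalize inner ℝ x y = u at *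
    simp only [coeff_add, coeff_C_mul, coeff_C_zero, coeff_C_succ, coeff_X_zero, coeff_X_one,
      coeff_X_pow, coeff_X_of_ne_one (show 2 ≠ 1 by decide)]
    have h1 := natCast_mul_pow_sub_one u p
    have h2 := choose_two_mul_pow_sub_two N b
    have key : ∀ i, (u ^ p * (b * N ^ (b - 1) + b.choose 2 * N ^ (b - 2) * (2 * x i) ^ 2)
        + p * u ^ (p - 1) * y i * (b * N ^ (b - 1) * (2 * x i))
        + p.choose 2 * u ^ (p - 2) * y i ^ 2 * N ^ b)
        = u ^ p * (b * N ^ (b - 1)) + u ^ p * b.choose 2 * N ^ (b - 2) * 4 * x i ^ 2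
        + 2 * p * u ^ (p - 1) * (b * N ^ (b - 1)) * (x i * y i)
        + p.choose 2 * u ^ (p - 2) * N ^ b * y i ^ 2 := fun i => by ring
    trans ∑ i, (u ^ p * (b * N ^ (b - 1) + b.choose 2 * N ^ (b - 2) * (2 * x i) ^ 2)
        + p * u ^ (p - 1) * y i * (b * N ^ (b - 1) * (2 * x i))
        + p.choose 2 * u ^ (p - 2) * y i ^ 2 * N ^ b)
    · refine Finset.sum_congr rfl fun i _ => ?_
      simp
    · simp only [key, Finset.sum_add_distrib, ← Finset.mul_sum, hyy, hxx, hxy, Finset.sum_const,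
        Finset.card_univ, Fintype.card_fin, nsmul_eq_mul]
      linear_combination 2 * b * N ^ (b - 1) * h1 + 2 * u ^ p * h2

end Laplacian

/-! ### The Laplacian of the mean of powers of projected lengths. -/

section Mean

variable {m : ℕ}

/-- The function `(t, s) ↦ ⟨x, t⟩ ⟨y, t⟩ + ⟨x, s⟩ ⟨y, s⟩`. -/
def planeForm (x y : EuclideanSpace ℝ (Fin m)) :
    C(EuclideanSpace ℝ (Fin m) × EuclideanSpace ℝ (Fin m), ℝ) :=
  ⟨fun p => inner ℝ x p.1 * inner ℝ y p.1 + inner ℝ x p.2 * inner ℝ y p.2, by fun_prop⟩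

theorem planeForm_apply (x y t s : EuclideanSpace ℝ (Fin m)) :
    planeForm x y (t, s) = inner ℝ x t * inner ℝ y t + inner ℝ x s * inner ℝ y s := rfl

/-- For each orthonormal pair, `planeForm x x` is the squared distance from the origin in a
two-dimensional plane, and there Δρ^(2k) = 4k²ρ^(2k-2). The factor `D` does not involve x. -/
theorem hasHalfLaplacian_stiefelMean (k : ℕ)
    (D : C(EuclideanSpace ℝ (Fin m) × EuclideanSpace ℝ (Fin m), ℝ)) :
    HasHalfLaplacian (fun x => stiefelMean (planeForm x x ^ k * D))
      (fun x => 2 * k ^ 2 * stiefelMean (planeForm x x ^ (k - 1) * D)) := by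
  intro x
  -- `P i` is the integrand along the line `x + r e_i`, as a polynomial in r whose coefficients are
  -- functions of (t, s).
  let P (i : Fin m) : Polynomial C(EuclideanSpace ℝ (Fin m) × EuclideanSpace ℝ (Fin m), ℝ) :=
    (Polynomial.C (planeForm x x)
      + Polynomial.C ((2 : ℝ) • planeForm x (EuclideanSpace.single i 1)) * Polynomial.X
      + Polynomial.C (planeForm (EuclideanSpace.single i 1) (EuclideanSpace.single i 1))
        * Polynomial.X ^ 2) ^ k * Polynomial.C D
  refine ⟨fun i => functionalPoly stiefelMean (P i), fun i r => ?_, ?_⟩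
  · rw [eval_functionalPoly]
    simp only [P, Polynomial.eval_mul, Polynomial.eval_pow, Polynomial.eval_add,
      Polynomial.eval_C, Polynomial.eval_X]
    congr 2
    ext ⟨t, s⟩
    simp [planeForm_apply, inner_add_left, inner_smul_left]
    ring
  · simp only [coeff_functionalPoly]
    rw [← map_sum, ← smul_eq_mul, ← map_smul]
    refine stiefelMean_congr fun t s ht hs hts => ?_
    have hsum (v w : EuclideanSpace ℝ (Fin m)) :
        ∑ i, inner ℝ (EuclideanSpace.single i 1) v * inner ℝ (EuclideanSpace.single i 1) w
          = (inner ℝ v w : ℝ) := by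
      rw [PiLp.inner_apply]
      simp [EuclideanSpace.inner_single_left, mul_comm]
    have h1 := hsum t t
    have h2 := hsum s s
    have h3 := hsum t s
    rw [real_inner_self_eq_norm_sq, ht, one_pow] at h1
    rw [real_inner_self_eq_norm_sq, hs, one_pow] at h2
    rw [hts] at h3
    simp only [P, Polynomial.coeff_mul_C, coeff_two_pow, ContinuousMap.sum_apply]
    simp [planeForm_apply, Polynomial.coeff_X, Polynomial.coeff_C, Polynomial.coeff_X_pow]
    generalize D (t, s) = d at *
    have key (X Y : ℝ) (a b : Fin m → ℝ) (h1 : ∑ i, a i * a i = 1) (h2 : ∑ i, b i * b i = 1)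
        (h3 : ∑ i, a i * b i = 0) :
        ∑ i, (k * (X * X + Y * Y) ^ (k - 1) * (a i * a i + b i * b i)
          + k.choose 2 * (X * X + Y * Y) ^ (k - 2) * (2 * (X * a i + Y * b i)) ^ 2)
        = 2 * k ^ 2 * (X * X + Y * Y) ^ (k - 1) := by
      have h5 := choose_two_mul_pow_sub_two (X * X + Y * Y) k
      have h6 : ∀ i, (k * (X * X + Y * Y) ^ (k - 1) * (a i * a i + b i * b i)
          + k.choose 2 * (X * X + Y * Y) ^ (k - 2) * (2 * (X * a i + Y * b i)) ^ 2)
          = (k * (X * X + Y * Y) ^ (k - 1)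
              + k.choose 2 * (X * X + Y * Y) ^ (k - 2) * 4 * X ^ 2) * (a i * a i)
            + (k * (X * X + Y * Y) ^ (k - 1)
              + k.choose 2 * (X * X + Y * Y) ^ (k - 2) * 4 * Y ^ 2) * (b i * b i)
            + k.choose 2 * (X * X + Y * Y) ^ (k - 2) * 8 * X * Y * (a i * b i) :=
        fun i => by ring
      simp only [h6, Finset.sum_add_distrib, ← Finset.mul_sum, h1, h2, h3]
      linear_combination 2 * h5
    rw [← Finset.sum_mul, ← mul_assoc]
    congr 1
    exact key _ _ _ _ h1 h2 h3

end Mean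

/-! ### Gegenbauer polynomials and a hypergeometric sum -/

/-- The coefficient of `t ^ (n - 2 * i)` in the Gegenbauer polynomial `C_n^lam(t)`. -/
def gegenbauerCoeff (lam : ℝ) (n i : ℕ) : ℝ :=
  if 2 * i ≤ n then (-1) ^ i * (ascPochhammer ℝ (n - i)).eval lam
      / ((i.factorial : ℝ) * ((n - 2 * i).factorial : ℝ)) * 2 ^ (n - 2 * i) else 0

/-- The coefficients extended by zero allow any long enough range, so that polynomials of different
degrees can be compared termwise. -/
theorem gegenbauer_eq_sum (lam : ℝ) {n M : ℕ} (hM : n / 2 < M) (t : ℝ) :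
    gegenbauer lam n t = ∑ i ∈ Finset.range M, gegenbauerCoeff lam n i * t ^ (n - 2 * i) := by
  rw [gegenbauer, ← Finset.sum_subset (Finset.range_subset_range.2 hM)]
  · refine Finset.sum_congr rfl fun i hi => ?_
    rw [Finset.mem_range] at hi
    rw [gegenbauerCoeff, if_pos (by omega), mul_pow]
    ring
  · intro i _ hi
    rw [Finset.mem_range] at hi
    rw [gegenbauerCoeff, if_neg (by omega), zero_mul]

theorem gegenbauerCoeff_zero_add_two (lam : ℝ) (n : ℕ) :
    (n + 2) * gegenbauerCoeff lam (n + 2) 0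
      = 2 * (n + 1 + lam) * gegenbauerCoeff lam (n + 1) 0 := by
  simp only [gegenbauerCoeff, mul_zero, Nat.zero_le, if_true, pow_zero, one_mul, Nat.sub_zero,
    Nat.factorial_zero, Nat.cast_one, ascPochhammer_succ_eval, Nat.factorial_succ]
  push_cast
  field_simp
  ring

/-- This is the coefficient of t^(n-2j) in the three-term recurrence (n+2) C_(n+2) = 2(n+1+λ) t
C_(n+1) - (n+2λ) C_n. -/
theorem gegenbauerCoeff_succ_add_two (lam : ℝ) (n j : ℕ) :
    (n + 2) * gegenbauerCoeff lam (n + 2) (j + 1)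
      = 2 * (n + 1 + lam) * gegenbauerCoeff lam (n + 1) (j + 1)
        - (n + 2 * lam) * gegenbauerCoeff lam n j := by
  rcases lt_trichotomy (2 * j) n with h | h | h
  · obtain ⟨d, rfl⟩ : ∃ d, n = 2 * j + 1 + d := ⟨n - (2 * j + 1), by omega⟩
    rw [gegenbauerCoeff, gegenbauerCoeff, gegenbauerCoeff, if_pos (by omega), if_pos (by omega),
      if_pos (by omega)]
    rw [show 2 * j + 1 + d + 2 - (j + 1) = j + d + 1 + 1 by omega,
      show 2 * j + 1 + d + 1 - (j + 1) = j + d + 1 by omega,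
      show 2 * j + 1 + d - j = j + d + 1 by omega,
      show 2 * j + 1 + d + 2 - 2 * (j + 1) = d + 1 by omega,
      show 2 * j + 1 + d + 1 - 2 * (j + 1) = d by omega,
      show 2 * j + 1 + d - 2 * j = d + 1 by omega]
    rw [ascPochhammer_succ_eval (j + d + 1), Nat.factorial_succ j, Nat.factorial_succ d]
    push_cast
    field_simp
    ring
  -- Here the power is t⁰, to which t C_(n+1) contributes nothing.
  · subst h
    rw [gegenbauerCoeff, gegenbauerCoeff, gegenbauerCoeff, if_pos (by omega), if_neg (by omega),
      if_pos (by omega)]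
    rw [show 2 * j + 2 - (j + 1) = j + 1 by omega, show 2 * j - j = j by omega,
      show 2 * j + 2 - 2 * (j + 1) = 0 by omega, show 2 * j - 2 * j = 0 by omega,
      ascPochhammer_succ_eval, Nat.factorial_succ j]
    push_cast
    field_simp
    ring
  · rw [gegenbauerCoeff, gegenbauerCoeff, gegenbauerCoeff, if_neg (by omega), if_neg (by omega),
      if_neg (by omega)]
    ring

theorem gegenbauer_one_add_two (lam : ℝ) (n : ℕ) :
    (n + 2) * gegenbauer lam (n + 2) 1
      = 2 * (n + 1 + lam) * gegenbauer lam (n + 1) 1 - (n + 2 * lam) * gegenbauer lam n 1 := by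
  rw [gegenbauer_eq_sum lam (M := n + 2) (by omega), gegenbauer_eq_sum lam (M := n + 2) (by omega),
    gegenbauer_eq_sum lam (M := n + 1) (by omega)]
  simp only [one_pow, mul_one]
  rw [Finset.sum_range_succ', Finset.sum_range_succ' _ (n + 1), mul_add, mul_add,
    gegenbauerCoeff_zero_add_two, Finset.mul_sum, Finset.mul_sum, Finset.mul_sum]
  simp only [gegenbauerCoeff_succ_add_two, Finset.sum_sub_distrib]
  ring

/-- `C_n^lam(1) = (2 lam)_n / n!`. -/
theorem gegenbauer_one (lam : ℝ) (n : ℕ) :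
    gegenbauer lam n 1 = (ascPochhammer ℝ n).eval (2 * lam) / n.factorial := by
  induction n using Nat.twoStepInduction with
  | zero => simp [gegenbauer]
  | one => simp [gegenbauer]; ring
  | more n h0 h1 =>
    have h := gegenbauer_one_add_two lam n
    rw [h0, h1] at h
    have hn : (n + 2 : ℝ) ≠ 0 := by positivity
    rw [← mul_right_inj' hn, h]
    simp only [ascPochhammer_succ_eval, Nat.factorial_succ]
    push_cast
    field_simp
    ring

/-- `(n + lam) / lam C_n^lam = C_n^(lam + 1) - C_(n - 2)^(lam + 1)`. -/
theorem gegenbauer_add_one_sub (lam : ℝ) (hlam : lam ≠ 0) (n : ℕ) (t : ℝ) :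
    (n + 2 + lam) / lam * gegenbauer lam (n + 2) t
      = gegenbauer (lam + 1) (n + 2) t - gegenbauer (lam + 1) n t := by
  -- This brings all three families of coefficients to Pochhammer symbols of base `lam + 1`.
  have hP (j : ℕ) : (ascPochhammer ℝ (j + 1)).eval lam
      = lam * (ascPochhammer ℝ j).eval (lam + 1) := by
    rw [ascPochhammer_succ_left]
    simp [Polynomial.eval_comp]
  rw [gegenbauer_eq_sum lam (M := n / 2 + 2) (by omega),
    gegenbauer_eq_sum (lam + 1) (M := n / 2 + 2) (by omega),
    gegenbauer_eq_sum (lam + 1) (M := n / 2 + 1) (by omega),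
    Finset.sum_range_succ', Finset.sum_range_succ' _ (n / 2 + 1), mul_add, Finset.mul_sum,
    add_sub_right_comm, ← Finset.sum_sub_distrib]
  congr 1
  · refine Finset.sum_congr rfl fun i hi => ?_
    rw [Finset.mem_range] at hi
    obtain ⟨d, rfl⟩ : ∃ d, n = 2 * i + d := ⟨n - 2 * i, by omega⟩
    rw [gegenbauerCoeff, gegenbauerCoeff, gegenbauerCoeff, if_pos (by omega), if_pos (by omega),
      if_pos (by omega)]
    rw [show 2 * i + d + 2 - (i + 1) = i + d + 1 by omega,
      show 2 * i + d + 2 - 2 * (i + 1) = d by omega,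
      show 2 * i + d - i = i + d by omega, show 2 * i + d - 2 * i = d by omega, hP,
      ascPochhammer_succ_eval, Nat.factorial_succ]
    push_cast
    field_simp
    ring
  · simp only [gegenbauerCoeff, mul_zero, Nat.zero_le, if_true, pow_zero, one_mul, Nat.sub_zero,
      hP, ascPochhammer_succ_eval]
    push_cast
    field_simp
    ring

/-- The terms of a terminating well-poised hypergeometric series. -/
def wellPoisedTerm (a : ℝ) (k l n : ℕ) : ℝ :=
  a * (2 * n + a) * Real.Gamma (a + n) ^ 2 * (k.factorial * k.choose n) * (l.factorial * l.choose n)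
    / (Real.Gamma (a + 1 + k + n) * Real.Gamma (a + 1 + l + n))

/-- The certificate for `sum_wellPoisedTerm`. -/
def wellPoisedCert (a : ℝ) (k l n : ℕ) : ℝ :=
  -(n ^ 2 * (a + l + n) * a * Real.Gamma (a + n) ^ 2 * (k.factorial * (k + 1).choose n / (k + 1))
    * (l.factorial * l.choose n) / (Real.Gamma (a + 1 + k + n) * Real.Gamma (a + 1 + l + n)))

/-- This is Zeilberger's method: a first-order recurrence in k for the summand holds up to a
difference in n. After all Gamma values and binomials are reduced to common ones, it is a rational
identity. -/
theorem wellPoisedTerm_telescope {a : ℝ} (ha : 0 < a) (k l n : ℕ) :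
    (a + 1 + k + l) * wellPoisedTerm a (k + 1) l n - (k + l + 1) * wellPoisedTerm a k l n
      = wellPoisedCert a k l (n + 1) - wellPoisedCert a k l n := by
  have hP : Real.Gamma (a + 1 + k + n) ≠ 0 := (Real.Gamma_pos_of_pos (by positivity)).ne'
  have hW : Real.Gamma (a + 1 + l + n) ≠ 0 := (Real.Gamma_pos_of_pos (by positivity)).ne'
  have hX : Real.Gamma (a + (n + 1 : ℕ)) = (a + n) * Real.Gamma (a + n) := by
    rw [← Real.Gamma_add_one (by positivity)]; push_cast; ring_nf
  have hP1 : Real.Gamma (a + 1 + (k + 1 : ℕ) + n) = (a + 1 + k + n) * Real.Gamma (a + 1 + k + n) := by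
    rw [← Real.Gamma_add_one (by positivity)]; push_cast; ring_nf
  have hP2 : Real.Gamma (a + 1 + k + (n + 1 : ℕ)) = (a + 1 + k + n) * Real.Gamma (a + 1 + k + n) := by
    rw [← Real.Gamma_add_one (by positivity)]; push_cast; ring_nf
  have hW2 : Real.Gamma (a + 1 + l + (n + 1 : ℕ)) = (a + 1 + l + n) * Real.Gamma (a + 1 + l + n) := by
    rw [← Real.Gamma_add_one (by positivity)]; push_cast; ring_nf
  have hc1 : ((k : ℝ) + 1) * k.choose n = (k + 1).choose (n + 1) * (n + 1) := by
    exact_mod_cast Nat.add_one_mul_choose_eq k n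
  have hd : (l.choose (n + 1) : ℝ) * (n + 1) = l.choose n * (l - n) := by
    rcases le_or_gt n l with h | h
    · rw [← Nat.cast_sub h]; exact_mod_cast Nat.choose_succ_right_eq l n
    · rw [Nat.choose_eq_zero_of_lt h, Nat.choose_eq_zero_of_lt (by omega)]; simp
  have hc : ((k + 1).choose n : ℝ) * (k + 1 - n) = (k + 1) * k.choose n := by
    rcases le_or_gt n (k + 1) with h | h
    · have := Nat.choose_mul_succ_eq k n
      have h2 : ((k + 1 - n : ℕ) : ℝ) = k + 1 - n := by rw [Nat.cast_sub h]; push_cast; ring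
      rw [← h2, mul_comm ((k : ℝ) + 1)]
      exact_mod_cast this.symm
    · rw [Nat.choose_eq_zero_of_lt h, Nat.choose_eq_zero_of_lt (by omega)]; simp
  rw [wellPoisedTerm, wellPoisedTerm, wellPoisedCert, wellPoisedCert, hX, hP1, hP2, hW2,
    Nat.factorial_succ]
  have hk : (k + 1 : ℝ) ≠ 0 := by positivity
  have e1 : (k.choose n : ℝ) = (k + 1).choose n * (k + 1 - n) / (k + 1) := by
    rw [hc]; field_simp
  have e2 : ((k + 1).choose (n + 1) : ℝ) = (k + 1) * k.choose n / (n + 1) := by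
    rw [hc1]; field_simp
  have e3 : (l.choose (n + 1) : ℝ) = l.choose n * (l - n) / (n + 1) := by
    rw [← hd]; field_simp
  have hs1 : a + 1 + k + n ≠ 0 := by positivity
  have hs2 : a + 1 + l + n ≠ 0 := by positivity
  rw [e2, e3, e1]
  push_cast
  generalize Real.Gamma (a + 1 + k + n) = P at *
  generalize Real.Gamma (a + 1 + l + n) = W at *
  generalize Real.Gamma (a + n) = X at *
  have hs3 : a + l + (n + 1) = a + 1 + l + n := by ring
  rw [hs3]
  field_simp
  ring

/-- Telescoping gives (a+1+k+l) S(k+1) = (k+l+1) S(k), a recurrence that the right side satisfies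
too; for k = 0 only n = 0 is present. -/
theorem sum_wellPoisedTerm {a : ℝ} (ha : 0 < a) (k l : ℕ) :
    ∑ n ∈ Finset.range (k + 1), wellPoisedTerm a k l n
      = (k + l).factorial * Real.Gamma (a + 1) / Real.Gamma (a + 1 + k + l) := by
  induction k with
  | zero =>
    have h1 : Real.Gamma (a + 1) = a * Real.Gamma a := Real.Gamma_add_one ha.ne'
    have h2 := (Real.Gamma_pos_of_pos ha).ne'
    have h3 : Real.Gamma (a + 1 + l) ≠ 0 := (Real.Gamma_pos_of_pos (by positivity)).ne'
    simp [wellPoisedTerm, h1]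
    field_simp
  | succ k ih =>
    -- The binomial coefficient kills terms beyond k, so both sums may run up to k + 1.
    have h0 : wellPoisedTerm a k l (k + 1) = 0 := by simp [wellPoisedTerm]
    have h1 := Finset.sum_range_sub (wellPoisedCert a k l) (k + 2)
    simp only [← wellPoisedTerm_telescope ha] at h1
    rw [Finset.sum_sub_distrib, ← Finset.mul_sum, ← Finset.mul_sum,
      Finset.sum_range_succ (wellPoisedTerm a k l), h0, add_zero, ih] at h1
    have h2 : wellPoisedCert a k l (k + 2) = 0 := by simp [wellPoisedCert]
    have h3 : wellPoisedCert a k l 0 = 0 := by simp [wellPoisedCert]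
    rw [h2, h3, sub_zero, sub_eq_zero] at h1
    have hs : a + 1 + k + l ≠ 0 := by positivity
    rw [← mul_right_inj' hs, h1, show a + 1 + (k + 1 : ℕ) + l = a + 1 + k + l + 1 by push_cast; ring,
      Real.Gamma_add_one hs, show k + 1 + l = k + l + 1 by ring, Nat.factorial_succ]
    have h3 : Real.Gamma (a + 1 + k + l) ≠ 0 := (Real.Gamma_pos_of_pos (by positivity)).ne'
    push_cast
    field_simp

/-! ### Zonal polynomials -/

section Zonal

variable {m : ℕ}

/-- The monomial `⟨x, y⟩ ^ (2 (k - b)) |x| ^ (2 b)` as a function of `x`. -/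
def zonalMonomial (y : EuclideanSpace ℝ (Fin m)) (k b : ℕ) (x : EuclideanSpace ℝ (Fin m)) : ℝ :=
  inner ℝ x y ^ (2 * (k - b)) * (‖x‖ ^ 2) ^ b

/-- The even polynomials in `⟨x, y⟩` and `|x|` that are homogeneous of degree `2 k`. -/
def IsZonal (y : EuclideanSpace ℝ (Fin m)) (k : ℕ) (f : EuclideanSpace ℝ (Fin m) → ℝ) : Prop :=
  ∃ q : ℕ → ℝ, ∀ x, f x = ∑ b ∈ Finset.range (k + 1), q b * zonalMonomial y k b x

variable {y : EuclideanSpace ℝ (Fin m)} {k : ℕ}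

theorem IsZonal.add {f g : EuclideanSpace ℝ (Fin m) → ℝ} (hf : IsZonal y k f)
    (hg : IsZonal y k g) : IsZonal y k (fun x => f x + g x) := by
  obtain ⟨p, hp⟩ := hf
  obtain ⟨q, hq⟩ := hg
  exact ⟨fun b => p b + q b, fun x => by simp only [hp, hq, add_mul, Finset.sum_add_distrib]⟩

theorem IsZonal.const_mul {f : EuclideanSpace ℝ (Fin m) → ℝ} (c : ℝ) (hf : IsZonal y k f) :
    IsZonal y k (fun x => c * f x) := by
  obtain ⟨p, hp⟩ := hf
  exact ⟨fun b => c * p b, fun x => by simp only [hp, mul_assoc, Finset.mul_sum]⟩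

theorem IsZonal.sub {f g : EuclideanSpace ℝ (Fin m) → ℝ} (hf : IsZonal y k f)
    (hg : IsZonal y k g) : IsZonal y k (fun x => f x - g x) := by
  simpa only [neg_one_mul, ← sub_eq_add_neg] using hf.add (hg.const_mul (-1))

theorem IsZonal.sum {ι : Type*} (s : Finset ι) {f : ι → EuclideanSpace ℝ (Fin m) → ℝ}
    (hf : ∀ j ∈ s, IsZonal y k (f j)) : IsZonal y k (fun x => ∑ j ∈ s, f j x) := by
  classical
  induction s using Finset.induction_on with
  | empty => exact ⟨fun _ => 0, by simp⟩
  | insert a s ha ih =>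
    simp only [Finset.sum_insert ha]
    exact (hf a (by simp)).add (ih fun j hj => hf j (by simp [hj]))

theorem isZonal_monomial {b : ℕ} (hb : b ≤ k) : IsZonal y k (zonalMonomial y k b) := by
  refine ⟨fun i => if i = b then 1 else 0, fun x => ?_⟩
  simp only [ite_mul, one_mul, zero_mul, Finset.sum_ite_eq', Finset.mem_range]
  rw [if_pos (by omega)]

theorem isZonal_mul_sub_pow (y : EuclideanSpace ℝ (Fin m)) (a c : ℕ) :
    IsZonal y (a + c)
      (fun x => (inner ℝ x y ^ 2) ^ a * (‖x‖ ^ 2 - inner ℝ x y ^ 2) ^ c) := by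
  have h : (fun x => (inner ℝ x y ^ 2) ^ a * (‖x‖ ^ 2 - inner ℝ x y ^ 2) ^ c) = fun x =>
      ∑ j ∈ Finset.range (c + 1), ((-1) ^ (c - j) * c.choose j) * zonalMonomial y (a + c) j x := by
    funext x
    rw [sub_eq_add_neg, add_pow, Finset.mul_sum]
    refine Finset.sum_congr rfl fun j hj => ?_
    rw [Finset.mem_range] at hj
    rw [zonalMonomial, show 2 * (a + c - j) = 2 * a + 2 * (c - j) by omega, pow_add, pow_mul,
      pow_mul, neg_pow]
    ring
  rw [h]
  refine IsZonal.sum _ fun j hj => (isZonal_monomial ?_).const_mul _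
  rw [Finset.mem_range] at hj
  omega

theorem exists_unit_orthogonal (hm : 2 ≤ m) (y : EuclideanSpace ℝ (Fin m)) :
    ∃ z : EuclideanSpace ℝ (Fin m), ‖z‖ = 1 ∧ inner ℝ y z = 0 := by
  have h : (Submodule.span ℝ {y})ᗮ ≠ ⊥ := by
    intro h
    rw [Submodule.orthogonal_eq_bot_iff] at h
    have h1 : Module.finrank ℝ (Submodule.span ℝ {y}) ≤ 1 := by
      simpa using finrank_span_le_card (R := ℝ) ({y} : Set (EuclideanSpace ℝ (Fin m)))
    rw [h, finrank_top, finrank_euclideanSpace_fin] at h1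
    omega
  obtain ⟨v, hv, hv0⟩ := Submodule.exists_mem_ne_zero_of_ne_bot h
  refine ⟨‖v‖⁻¹ • v, norm_smul_inv_norm hv0, ?_⟩
  rw [inner_smul_right, Submodule.mem_orthogonal_singleton_iff_inner_right.1 hv, mul_zero]

/-- At `y + √(r - 1) z`, with z a unit vector orthogonal to y, the inner product with y is 1 and the
squared norm is r. A linear relation becomes a polynomial in r that vanishes on [1, ∞). -/
theorem zonalMonomial_linearIndependent (hm : 2 ≤ m) (hy : ‖y‖ = 1) {c : ℕ → ℝ}
    (h : ∀ x, ∑ b ∈ Finset.range (k + 1), c b * zonalMonomial y k b x = 0) {b : ℕ} (hb : b ≤ k) :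
    c b = 0 := by
  obtain ⟨z, hz, hyz⟩ := exists_unit_orthogonal hm y
  let P : Polynomial ℝ := ∑ b ∈ Finset.range (k + 1), Polynomial.monomial b (c b)
  have hP : P = 0 := by
    refine Polynomial.eq_zero_of_infinite_isRoot P ((Set.Ici_infinite (1 : ℝ)).mono fun r hr => ?_)
    have h1 := h (y + Real.sqrt (r - 1) • z)
    have hu : inner ℝ (y + Real.sqrt (r - 1) • z) y = (1 : ℝ) := by
      rw [inner_add_left, inner_smul_left, real_inner_self_eq_norm_sq, hy, real_inner_comm, hyz]
      simp
    have hN : ‖y + Real.sqrt (r - 1) • z‖ ^ 2 = r := by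
      rw [norm_add_sq_real, inner_smul_right, hyz, norm_smul, hy, hz, mul_one, Real.norm_eq_abs,
        sq_abs, Real.sq_sqrt (by simpa using hr)]
      ring
    simp only [zonalMonomial, hu, hN, one_pow, one_mul] at h1
    simpa [P, Polynomial.eval_finsetSum] using h1
  have h2 : P.coeff b = c b := by
    simp only [P, Polynomial.finsetSum_coeff, Polynomial.coeff_monomial, Finset.sum_ite_eq',
      Finset.mem_range]
    rw [if_pos (by omega)]
  rw [← h2, hP, Polynomial.coeff_zero]

theorem choose_two_two_mul (n : ℕ) : ((2 * n).choose 2 : ℝ) = n * (2 * n - 1) := by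
  rw [Nat.cast_choose_two]; push_cast; ring

theorem hasHalfLaplacian_sum_zonalMonomial (hy : ‖y‖ = 1) (k : ℕ) (q : ℕ → ℝ) :
    HasHalfLaplacian (fun x => ∑ b ∈ Finset.range (k + 1 + 1), q b * zonalMonomial y (k + 1) b x)
      (fun x => ∑ b ∈ Finset.range (k + 1),
        (q b * ((k + 1 - b) * (2 * (k + 1 - b) - 1))
          + q (b + 1) * ((b + 1) * (4 * (k - b) + m + 2 * b))) * zonalMonomial y k b x) := by
  have h := HasHalfLaplacian.sum (Finset.range (k + 1 + 1)) fun b _ =>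
    (hasHalfLaplacian_monomial hy (2 * (k + 1 - b)) b).const_mul (q b)
  convert h using 1
  · rfl
  funext x
  simp only [mul_add (q _), Finset.sum_add_distrib]
  have hA : ∑ b ∈ Finset.range (k + 1 + 1), q b * (((2 * (k + 1 - b)).choose 2 : ℝ) *
      (inner ℝ x y ^ (2 * (k + 1 - b) - 2) * (‖x‖ ^ 2) ^ b)) = ∑ b ∈ Finset.range (k + 1),
        q b * ((k + 1 - b) * (2 * (k + 1 - b) - 1)) * zonalMonomial y k b x := by
    rw [Finset.sum_range_succ, Nat.sub_self]
    simp only [mul_zero, Nat.choose_zero_succ, Nat.cast_zero, zero_mul, add_zero]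
    refine Finset.sum_congr rfl fun b hb => ?_
    rw [Finset.mem_range] at hb
    rw [choose_two_two_mul, zonalMonomial, show 2 * (k + 1 - b) - 2 = 2 * (k - b) by omega,
      Nat.cast_sub (by omega)]
    push_cast
    ring
  have hB : ∑ b ∈ Finset.range (k + 1 + 1), q b *
      (b * (2 * (2 * (k + 1 - b) : ℕ) + m + 2 * b - 2) *
        (inner ℝ x y ^ (2 * (k + 1 - b)) * (‖x‖ ^ 2) ^ (b - 1))) = ∑ b ∈ Finset.range (k + 1),
        q (b + 1) * ((b + 1) * (4 * (k - b) + m + 2 * b)) * zonalMonomial y k b x := by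
    rw [Finset.sum_range_succ']
    simp only [Nat.cast_zero, zero_mul, mul_zero, add_zero]
    refine Finset.sum_congr rfl fun b hb => ?_
    rw [Finset.mem_range] at hb
    rw [zonalMonomial, show k + 1 - (b + 1) = k - b by omega, Nat.add_sub_cancel]
    push_cast
    rw [Nat.cast_sub (by omega)]
    ring
  rw [hA, hB, ← Finset.sum_add_distrib]
  exact Finset.sum_congr rfl fun b _ => by rw [add_mul]

/-- This is the vanishing of the coefficients in `hasHalfLaplacian_sum_zonalMonomial`, that is, the
harmonicity of `zonalPoly`. -/
theorem gegenbauerCoeff_recurrence {n b : ℕ} (hb : b < n) :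
    gegenbauerCoeff ((m : ℝ) / 2 - 1) (2 * n) b * ((n - b) * (2 * (n - b) - 1))
      + gegenbauerCoeff ((m : ℝ) / 2 - 1) (2 * n) (b + 1)
        * ((b + 1) * (4 * (n - 1 - b) + m + 2 * b)) = 0 := by
  obtain ⟨d, rfl⟩ : ∃ d, n = b + d + 1 := ⟨n - b - 1, by omega⟩
  rw [gegenbauerCoeff, gegenbauerCoeff, if_pos (by omega), if_pos (by omega),
    show 2 * (b + d + 1) - b = b + 2 * d + 1 + 1 by omega,
    show 2 * (b + d + 1) - (b + 1) = b + 2 * d + 1 by omega,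
    show 2 * (b + d + 1) - 2 * b = 2 * d + 1 + 1 by omega,
    show 2 * (b + d + 1) - 2 * (b + 1) = 2 * d by omega,
    ascPochhammer_succ_eval (b + 2 * d + 1), Nat.factorial_succ b, Nat.factorial_succ (2 * d + 1),
    Nat.factorial_succ (2 * d)]
  push_cast
  field_simp
  ring

/-- The zonal harmonic polynomial `|x| ^ (2 n) C_(2 n)^(m / 2 - 1)(⟨x, y⟩ / |x|)`. -/
def zonalPoly (y : EuclideanSpace ℝ (Fin m)) (n : ℕ) (x : EuclideanSpace ℝ (Fin m)) : ℝ :=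
  ∑ i ∈ Finset.range (n + 1), gegenbauerCoeff ((m : ℝ) / 2 - 1) (2 * n) i * zonalMonomial y n i x

theorem zonalPoly_self (hy : ‖y‖ = 1) (n : ℕ) :
    zonalPoly y n y = gegenbauer ((m : ℝ) / 2 - 1) (2 * n) 1 := by
  rw [gegenbauer_eq_sum (M := n + 1) _ (by omega), zonalPoly]
  simp [zonalMonomial, hy]

theorem hasHalfLaplacian_zonalPoly (hy : ‖y‖ = 1) (c n : ℕ) :
    HasHalfLaplacian (fun x => (‖x‖ ^ 2) ^ c * zonalPoly y n x)
      (fun x => c * (4 * n + 2 * c + m - 2) * ((‖x‖ ^ 2) ^ (c - 1) * zonalPoly y n x)) := by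
  have h := HasHalfLaplacian.sum (Finset.range (n + 1)) fun i _ =>
    (hasHalfLaplacian_monomial hy (2 * (n - i)) (c + i)).const_mul
      (gegenbauerCoeff ((m : ℝ) / 2 - 1) (2 * n) i)
  convert h using 1
  · funext x
    rw [zonalPoly, Finset.mul_sum]
    refine Finset.sum_congr rfl fun i _ => ?_
    rw [zonalMonomial, pow_add]
    ring
  · funext x
    set g := gegenbauerCoeff ((m : ℝ) / 2 - 1) (2 * n) with hg
    set u : ℝ := inner ℝ x y with hu
    set N := ‖x‖ ^ 2 with hN
    -- This is the harmonicity of `zonalPoly y n` multiplied by `N ^ c`; subtracting it leaves only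
    -- the terms with a factor c.
    have hA : ∑ i ∈ Finset.range (n + 1), g i * ((n - i) * (2 * (n - i) - 1)) *
        (u ^ (2 * (n - i) - 2) * N ^ (c + i))
        + ∑ i ∈ Finset.range (n + 1), g i * (i * (4 * n - 2 * i + m - 2)) *
          (u ^ (2 * (n - i)) * N ^ (c + i - 1)) = 0 := by
      rw [Finset.sum_range_succ, Finset.sum_range_succ' (fun i => g i * (i * _) * _)]
      simp only [sub_self, Nat.cast_zero, zero_mul, mul_zero, add_zero, ← Finset.sum_add_distrib]
      refine Finset.sum_eq_zero fun i hi => ?_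
      rw [Finset.mem_range] at hi
      have h1 := gegenbauerCoeff_recurrence (m := m) hi
      rw [← hg] at h1
      rw [show 2 * (n - i) - 2 = 2 * (n - (i + 1)) by omega, show c + (i + 1) - 1 = c + i by omega]
      push_cast
      linear_combination (u ^ (2 * (n - (i + 1))) * N ^ (c + i)) * h1
    rw [zonalPoly, Finset.mul_sum, Finset.mul_sum]
    rw [← add_zero (∑ i ∈ Finset.range (n + 1), _), ← hA, ← Finset.sum_add_distrib,
      ← Finset.sum_add_distrib]
    refine Finset.sum_congr rfl fun i hi => ?_
    rw [Finset.mem_range] at hi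
    rw [choose_two_two_mul, zonalMonomial, Nat.cast_mul, Nat.cast_sub (by omega)]
    rcases c with _ | c
    · simp only [Nat.cast_zero, zero_add]
      push_cast
      ring
    · rw [show c + 1 + i - 1 = c + i by omega, show c + 1 - 1 = c by omega]
      push_cast
      ring

theorem IsZonal.zonalPoly {n : ℕ} (hn : n ≤ k) :
    IsZonal y k (fun x => (‖x‖ ^ 2) ^ (k - n) * zonalPoly y n x) := by
  have h : (fun x => (‖x‖ ^ 2) ^ (k - n) * _root_.zonalPoly y n x) = fun x =>
      ∑ i ∈ Finset.range (n + 1), gegenbauerCoeff ((m : ℝ) / 2 - 1) (2 * n) i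
        * zonalMonomial y k (k - n + i) x := by
    funext x
    rw [_root_.zonalPoly, Finset.mul_sum]
    refine Finset.sum_congr rfl fun i hi => ?_
    rw [Finset.mem_range] at hi
    rw [zonalMonomial, zonalMonomial, show k - (k - n + i) = n - i by omega, pow_add]
    ring
  rw [h]
  refine IsZonal.sum _ fun i hi => (isZonal_monomial ?_).const_mul _
  rw [Finset.mem_range] at hi
  omega

theorem gegenbauer_one_pos {lam : ℝ} (hlam : 0 < lam) (n : ℕ) : 0 < gegenbauer lam n 1 := by
  rw [gegenbauer_one]
  have := ascPochhammer_pos n (2 * lam) (by positivity)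
  positivity

/-- Harmonicity is a two-term recurrence for the coefficients, so f is a multiple of `zonalPoly y
k`, whose value at y is C_(2k)(1) > 0. -/
theorem IsZonal.eq_zero (hm : 3 ≤ m) (hy : ‖y‖ = 1) {f : EuclideanSpace ℝ (Fin m) → ℝ}
    (hf : IsZonal y k f) (hL : HasHalfLaplacian f (fun _ => 0)) (h0 : f y = 0) (x) : f x = 0 := by
  have hlam : 0 < (m : ℝ) / 2 - 1 := by
    have : (3 : ℝ) ≤ m := by exact_mod_cast hm
    linarith
  obtain ⟨q, hq⟩ := hf
  set g := gegenbauerCoeff ((m : ℝ) / 2 - 1) (2 * k) with hg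
  have hg0 : g 0 ≠ 0 := by
    simp only [hg, gegenbauerCoeff, mul_zero, Nat.zero_le, if_true, Nat.sub_zero]
    have := ascPochhammer_pos (2 * k) _ hlam
    positivity
  have hqg : ∀ b ≤ k, q b = q 0 / g 0 * g b := by
    intro b
    induction b with
    | zero => intro _; field_simp
    | succ b ih =>
      intro hb
      obtain ⟨k, rfl⟩ : ∃ n, k = n + 1 := ⟨k - 1, by omega⟩
      have h1 := hasHalfLaplacian_sum_zonalMonomial hy k q
      rw [← funext hq] at h1
      have h2 := zonalMonomial_linearIndependent (by omega) hy
        (fun x => congrFun (h1.unique hL) x) (b := b) (by omega)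
      have h3 := gegenbauerCoeff_recurrence (m := m) (n := k + 1) (b := b) (by omega)
      rw [← hg] at h3
      rw [ih (by omega)] at h2
      have hbk : (b : ℝ) ≤ k := by exact_mod_cast (by omega : b ≤ k)
      have hs : ((b : ℝ) + 1) * (4 * (k - b) + m + 2 * b) ≠ 0 := by
        have : (3 : ℝ) ≤ m := by exact_mod_cast hm
        have : (0 : ℝ) ≤ b := by positivity
        refine mul_ne_zero (by positivity) ?_
        have : 0 < 4 * ((k : ℝ) - b) + m + 2 * b := by linarith
        exact this.ne'
      rw [← mul_left_inj' hs]
      push_cast at h3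
      linear_combination h2 - q 0 / g 0 * h3
  have hfx : ∀ x, f x = q 0 / g 0 * _root_.zonalPoly y k x := by
    intro x
    rw [hq, _root_.zonalPoly, Finset.mul_sum]
    refine Finset.sum_congr rfl fun b hb => ?_
    rw [Finset.mem_range] at hb
    rw [hqg b (by omega), mul_assoc]
  rw [hfx, zonalPoly_self hy] at h0
  rw [hfx, (mul_eq_zero.1 h0).resolve_right (gegenbauer_one_pos hlam _).ne', zero_mul]

end Zonal

/-! ### The zonal expansion of the scalar mean -/

section Expansion

variable {m : ℕ}

theorem stiefelMean_planeForm_isometry (k : ℕ)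
    {D : C(EuclideanSpace ℝ (Fin m) × EuclideanSpace ℝ (Fin m), ℝ)}
    (g : EuclideanSpace ℝ (Fin m) ≃ₗᵢ[ℝ] EuclideanSpace ℝ (Fin m))
    (hD : ∀ t s, D (g t, g s) = D (t, s)) (x : EuclideanSpace ℝ (Fin m)) :
    stiefelMean (planeForm (g x) (g x) ^ k * D) = stiefelMean (planeForm x x ^ k * D) := by
  rw [← stiefelMean_isometry _ g]
  congr 1
  ext ⟨t, s⟩
  simp [planeForm_apply, hD]

theorem planeForm_smul (c : ℝ) (x : EuclideanSpace ℝ (Fin m)) :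
    planeForm (c • x) (c • x) = c ^ 2 • planeForm x x := by
  ext ⟨t, s⟩
  simp only [planeForm_apply, inner_smul_left, ContinuousMap.smul_apply, smul_eq_mul]
  simp
  ring

theorem planeForm_isometry {y : EuclideanSpace ℝ (Fin m)}
    {g : EuclideanSpace ℝ (Fin m) ≃ₗᵢ[ℝ] EuclideanSpace ℝ (Fin m)} (hg : g y = y)
    (t s : EuclideanSpace ℝ (Fin m)) : planeForm y y (g t, g s) = planeForm y y (t, s) := by
  conv_lhs => rw [← hg]
  simp [planeForm_apply]

/-- The mean value of `|P x| ^ (2 j)`, where `P` is the orthogonal projection onto a random plane. -/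
theorem stiefelMean_planeForm_pow (hm : 3 ≤ m) (j : ℕ) (x : EuclideanSpace ℝ (Fin m)) :
    stiefelMean (planeForm x x ^ j) = j.factorial * Real.Gamma ((m : ℝ) / 2 - 1 + 1)
      / Real.Gamma ((m : ℝ) / 2 - 1 + 1 + j) * (‖x‖ ^ 2) ^ j := by
  have hm' : (3 : ℝ) ≤ m := by exact_mod_cast hm
  obtain ⟨y, hy, -⟩ := exists_unit_orthogonal (by omega : 2 ≤ m) 0
  -- A reflection takes x to ‖x‖ y, so the mean is a multiple of ‖x‖^(2j).
  have hrad : ∀ j x, stiefelMean (planeForm x x ^ j)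
      = stiefelMean (planeForm y y ^ j) * (inner ℝ x y ^ 0 * (‖x‖ ^ 2) ^ j) := by
    intro j x
    have h1 := stiefelMean_planeForm_isometry j (D := 1)
      ((Submodule.span ℝ {x - ‖x‖ • y})ᗮ.reflection) (fun _ _ => rfl) x
    rw [Submodule.reflection_sub (by simp [norm_smul, hy]), mul_one, mul_one, planeForm_smul,
      smul_pow, map_smul, smul_eq_mul] at h1
    rw [← h1, mul_comm, pow_zero, one_mul]
  rw [hrad, pow_zero, one_mul]
  congr 1
  induction j with
  | zero =>
    have : Real.Gamma ((m : ℝ) / 2 - 1 + 1) ≠ 0 := (Real.Gamma_pos_of_pos (by linarith)).ne'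
    rw [pow_zero, stiefelMean_one (by omega)]
    simp only [Nat.factorial_zero, Nat.cast_one, one_mul, Nat.cast_zero, add_zero, div_self this]
  | succ j ih =>
    have h1 := hasHalfLaplacian_stiefelMean (m := m) (j + 1) 1
    simp only [mul_one] at h1
    have h2 := (hasHalfLaplacian_monomial hy 0 (j + 1)).const_mul
      (stiefelMean (planeForm y y ^ (j + 1)))
    simp only [← hrad] at h2
    -- The half Laplacian, computed under the mean and from the radial form, gives a recurrence in j
    -- for the constant.
    have h3 := congrFun (h1.unique h2) y
    simp only [Nat.add_sub_cancel, hy, one_pow, ih] at h3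
    have hpos : 0 < (m : ℝ) / 2 - 1 + 1 + j := by
      have : (0 : ℝ) ≤ j := by positivity
      linarith
    have hG := (Real.Gamma_pos_of_pos hpos).ne'
    have e : ((m : ℝ) / 2 - 1 + 1 + (j + 1 : ℕ)) = (m : ℝ) / 2 - 1 + 1 + j + 1 := by
      push_cast; ring
    rw [e, Real.Gamma_add_one hpos.ne', Nat.factorial_succ]
    have h4 : 2 * ((j : ℝ) + 1) ^ 2 * (j.factorial * Real.Gamma ((m : ℝ) / 2 - 1 + 1)
        / Real.Gamma ((m : ℝ) / 2 - 1 + 1 + j))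
        = stiefelMean (planeForm y y ^ (j + 1))
          * (((j : ℝ) + 1) * (2 * ((m : ℝ) / 2 - 1 + 1 + j))) := by
      rw [← Nat.cast_add_one, h3, show Nat.choose 0 2 = 0 from rfl]
      push_cast
      ring
    push_cast
    generalize (m : ℝ) / 2 - 1 + 1 + j = v at *
    have hj : (j : ℝ) + 1 ≠ 0 := by positivity
    have hv : v ≠ 0 := hpos.ne'
    have h5 : 2 * v * ((j : ℝ) + 1) ≠ 0 := by positivity
    rw [← mul_left_inj' h5]
    refine Eq.trans ?_ (h4.symm.trans ?_)
    · ring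
    · field_simp

theorem stiefelMean_add_pow {R : Type*} [CommRing R] [Algebra ℝ R] (l : R →ₗ[ℝ] ℝ)
    (A B C D : R) (k : ℕ) (p q v : ℝ) :
    l ((v • B + (p • A + q • C)) ^ k * D) = ∑ j ∈ Finset.range (k + 1),
      ∑ h ∈ Finset.range (k - j + 1), v ^ j * (p ^ h * q ^ (k - j - h)) *
        l (B ^ j * (A ^ h * C ^ (k - j - h) * (k - j).choose h) * k.choose j * D) := by
  rw [add_pow, Finset.sum_mul, map_sum]
  refine Finset.sum_congr rfl fun j _ => ?_
  rw [add_pow, Finset.mul_sum, Finset.sum_mul, Finset.sum_mul, map_sum]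
  refine Finset.sum_congr rfl fun h _ => ?_
  rw [← smul_eq_mul (a := v ^ j * _), ← map_smul]
  congr 1
  simp only [Algebra.smul_def, map_mul, map_pow]
  ring

/-- By invariance, x may be replaced by u y + r z with z ⟂ y fixed, u = ⟨x, y⟩ and r² = ‖x‖² - u².
Both signs of r are allowed, so odd powers of r cancel and a polynomial in u² and r² remains. -/
theorem isZonal_stiefelMean (hm : 2 ≤ m) {y : EuclideanSpace ℝ (Fin m)} (hy : ‖y‖ = 1) (k l : ℕ) :
    IsZonal y k (fun x => stiefelMean (planeForm x x ^ k * planeForm y y ^ l)) := by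
  obtain ⟨z, hz, hyz⟩ := exists_unit_orthogonal hm y
  have hD {g : EuclideanSpace ℝ (Fin m) ≃ₗᵢ[ℝ] EuclideanSpace ℝ (Fin m)} (hg : g y = y)
      (t s : EuclideanSpace ℝ (Fin m)) :
      (planeForm y y ^ l) (g t, g s) = (planeForm y y ^ l) (t, s) := by
    simp only [ContinuousMap.pow_apply, planeForm_isometry hg]
  have hpos (x : EuclideanSpace ℝ (Fin m)) (r : ℝ) (hr : r ^ 2 = ‖x‖ ^ 2 - inner ℝ x y ^ 2) :
      stiefelMean (planeForm x x ^ k * planeForm y y ^ l) = stiefelMean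
        (planeForm (inner ℝ x y • y + r • z) (inner ℝ x y • y + r • z) ^ k * planeForm y y ^ l) := by
    have hxx : inner ℝ x y • y + (x - inner ℝ x y • y) = x := by abel
    have hnorm : ‖x - (inner ℝ x y : ℝ) • y‖ = ‖r • z‖ := by
      rw [← sq_eq_sq₀ (norm_nonneg _) (norm_nonneg _), norm_smul, hz, mul_one, Real.norm_eq_abs,
        sq_abs, hr, norm_sub_sq_real, inner_smul_right, norm_smul, hy, mul_one, Real.norm_eq_abs,
        sq_abs]
      ring
    -- This reflection fixes y and takes the component of x orthogonal to y to `r • z`.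
    let g := (Submodule.span ℝ {(x - (inner ℝ x y : ℝ) • y) - r • z})ᗮ.reflection
    have hgy : g y = y := by
      refine Submodule.reflection_mem_subspace_eq_self ?_
      rw [Submodule.mem_orthogonal_singleton_iff_inner_left, inner_sub_right, inner_sub_right,
        inner_smul_right, inner_smul_right, hyz, real_inner_self_eq_norm_sq, hy, real_inner_comm]
      ring
    have hgx : g x = (inner ℝ x y : ℝ) • y + r • z := by
      conv_lhs => rw [← hxx]
      rw [map_add, map_smul, hgy]
      congr 1
      exact Submodule.reflection_sub hnorm
    rw [← hgx]
    exact (stiefelMean_planeForm_isometry k g (hD hgy) x).symm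
  have hexp (u r : ℝ) : planeForm (u • y + r • z) (u • y + r • z)
      = (u * r) • ((2 : ℝ) • planeForm y z) + (u ^ 2 • planeForm y y + r ^ 2 • planeForm z z) := by
    ext ⟨t, s⟩
    simp [planeForm_apply, inner_add_left, inner_smul_left]
    ring
  let R := C(EuclideanSpace ℝ (Fin m) × EuclideanSpace ℝ (Fin m), ℝ)
  let M (j h : ℕ) : ℝ := stiefelMean (((2 : ℝ) • planeForm y z) ^ j *
    (planeForm y y ^ h * planeForm z z ^ (k - j - h) * ((k - j).choose h : R)) * (k.choose j : R)
      * planeForm y y ^ l)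
  have hf : (fun x => stiefelMean (planeForm x x ^ k * planeForm y y ^ l)) = fun x =>
      ∑ j ∈ Finset.range (k + 1), ∑ h ∈ Finset.range (k - j + 1),
        (if Even j then M j h else 0) * ((inner ℝ x y ^ 2) ^ (j / 2 + h) *
          (‖x‖ ^ 2 - inner ℝ x y ^ 2) ^ (k - j / 2 - h)) := by
    funext x
    have hnn : 0 ≤ ‖x‖ ^ 2 - inner ℝ x y ^ 2 := by
      have h1 := abs_real_inner_le_norm x y
      rw [hy, mul_one] at h1
      have h2 := sq_le_sq' (by linarith [neg_abs_le (inner ℝ x y : ℝ)])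
        ((le_abs_self (inner ℝ x y : ℝ)).trans h1)
      linarith
    set u : ℝ := inner ℝ x y with hu
    set w := ‖x‖ ^ 2 - u ^ 2 with hw
    have h1 := hpos x (Real.sqrt w) (Real.sq_sqrt hnn)
    have h2 := hpos x (-Real.sqrt w) (by rw [neg_sq]; exact Real.sq_sqrt hnn)
    rw [← hu, hexp, stiefelMean_add_pow] at h1 h2
    -- The mean is written as half the sum of its expansions at √w and -√w; the terms with odd j
    -- cancel.
    have h3 : stiefelMean (planeForm x x ^ k * planeForm y y ^ l)
      = (stiefelMean (planeForm x x ^ k * planeForm y y ^ l)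
        + stiefelMean (planeForm x x ^ k * planeForm y y ^ l)) / 2 := by ring
    rw [h3]
    nth_rw 1 [h1]
    rw [h2, ← Finset.sum_add_distrib, Finset.sum_div]
    refine Finset.sum_congr rfl fun j hj => ?_
    rw [← Finset.sum_add_distrib, Finset.sum_div]
    refine Finset.sum_congr rfl fun h hh => ?_
    rw [Finset.mem_range] at hj hh
    rw [neg_sq, Real.sq_sqrt hnn, mul_neg]
    change (_ * M j h + _ * M j h) / 2 = _
    split_ifs with he
    · obtain ⟨i, rfl⟩ := he
      have hsq : (u * Real.sqrt w) ^ (i + i) = (u ^ 2) ^ i * w ^ i := by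
        rw [← two_mul, pow_mul, mul_pow, Real.sq_sqrt hnn, mul_pow]
      rw [Even.neg_pow ⟨i, rfl⟩, show (i + i) / 2 = i by omega,
        show k - i - h = i + (k - (i + i) - h) by omega, hsq]
      ring
    · rw [(Nat.not_even_iff_odd.1 he).neg_pow]
      ring
  rw [hf]
  refine IsZonal.sum _ fun j hj => IsZonal.sum _ fun h hh => ?_
  rw [Finset.mem_range] at hj hh
  by_cases he : Even j
  · have := isZonal_mul_sub_pow y (j / 2 + h) (k - j / 2 - h)
    obtain ⟨i, rfl⟩ := he
    rw [show (i + i) / 2 + h + (k - (i + i) / 2 - h) = k by omega] at this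
    exact this.const_mul _
  · simp only [if_neg he, zero_mul]
    exact ⟨fun _ => 0, by simp⟩

/-- For a = m/2 - 1 this balances, up to a factor 2, the eigenvalue-type factor of
`hasHalfLaplacian_zonalPoly` against the 2(k+1)² of `hasHalfLaplacian_stiefelMean`. -/
theorem wellPoisedTerm_succ {a : ℝ} (ha : 0 < a) {k n : ℕ} (l : ℕ) (hn : n ≤ k) :
    (k + 1 - n) * (a + 1 + k + n) * wellPoisedTerm a (k + 1) l n
      = (k + 1) ^ 2 * wellPoisedTerm a k l n := by
  have hP : Real.Gamma (a + 1 + k + n) ≠ 0 := (Real.Gamma_pos_of_pos (by positivity)).ne'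
  have hs : a + 1 + k + n ≠ 0 := by positivity
  have hP1 : Real.Gamma (a + 1 + (k + 1 : ℕ) + n) = (a + 1 + k + n) * Real.Gamma (a + 1 + k + n) := by
    rw [← Real.Gamma_add_one hs]; push_cast; ring_nf
  have hc : ((k + 1).choose n : ℝ) * (k + 1 - n) = (k + 1) * k.choose n := by
    have := Nat.choose_mul_succ_eq k n
    have h2 : ((k + 1 - n : ℕ) : ℝ) = k + 1 - n := by rw [Nat.cast_sub (by omega)]; push_cast; ring
    rw [← h2, mul_comm ((k : ℝ) + 1)]
    exact_mod_cast this.symm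
  rw [wellPoisedTerm, wellPoisedTerm, hP1, Nat.factorial_succ]
  push_cast
  field_simp
  linear_combination (l.choose n : ℝ) * hc

/-- The difference of the two sides is zonal, harmonic by the case k - 1, and zero at y. The
exponent l is kept separate because the Laplacian in x lowers k alone. -/
theorem stiefelMean_eq_sum_zonalPoly (hm : 3 ≤ m) {y : EuclideanSpace ℝ (Fin m)} (hy : ‖y‖ = 1)
    (k l : ℕ) (x : EuclideanSpace ℝ (Fin m)) :
    stiefelMean (planeForm x x ^ k * planeForm y y ^ l) = ∑ n ∈ Finset.range (k + 1),
      wellPoisedTerm ((m : ℝ) / 2 - 1) k l n / gegenbauer ((m : ℝ) / 2 - 1) (2 * n) 1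
        * ((‖x‖ ^ 2) ^ (k - n) * zonalPoly y n x) := by
  have ha : 0 < (m : ℝ) / 2 - 1 := by
    have : (3 : ℝ) ≤ m := by exact_mod_cast hm
    linarith
  induction k using Nat.strong_induction_on generalizing x with | _ k ih
  have hZ := (isZonal_stiefelMean (by omega : 2 ≤ m) hy k l).sub
    (IsZonal.sum (Finset.range (k + 1)) fun n hn =>
      (IsZonal.zonalPoly (y := y) (Nat.lt_succ_iff.1 (Finset.mem_range.1 hn))).const_mul
        (wellPoisedTerm ((m : ℝ) / 2 - 1) k l n / gegenbauer ((m : ℝ) / 2 - 1) (2 * n) 1))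
  have hL := (hasHalfLaplacian_stiefelMean k (planeForm y y ^ l)).sub
    (HasHalfLaplacian.sum (Finset.range (k + 1)) fun n _ =>
      (hasHalfLaplacian_zonalPoly hy (k - n) n).const_mul
        (wellPoisedTerm ((m : ℝ) / 2 - 1) k l n / gegenbauer ((m : ℝ) / 2 - 1) (2 * n) 1))
  refine sub_eq_zero.1 (hZ.eq_zero hm hy ?_ ?_ x)
  · convert hL using 1
    funext x
    rcases k with _ | k
    · simp
    · rw [Nat.add_sub_cancel, ih k (by omega), Finset.sum_range_succ _ (k + 1), Nat.sub_self,
        Nat.cast_zero, zero_mul, zero_mul, mul_zero, add_zero, eq_comm, sub_eq_zero,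
        Finset.mul_sum]
      refine Finset.sum_congr rfl fun n hn => ?_
      rw [Finset.mem_range] at hn
      have h := wellPoisedTerm_succ ha l (by omega : n ≤ k)
      rw [Nat.cast_sub (by omega), show k + 1 - n - 1 = k - n by omega]
      push_cast
      linear_combination (-2 * ((‖x‖ ^ 2) ^ (k - n) * zonalPoly y n x)
        / gegenbauer ((m : ℝ) / 2 - 1) (2 * n) 1) * h
  · rw [← pow_add, stiefelMean_planeForm_pow hm, sub_eq_zero, hy]
    have h := sum_wellPoisedTerm ha k l
    rw [show (m : ℝ) / 2 - 1 + 1 + (k + l : ℕ) = (m : ℝ) / 2 - 1 + 1 + k + l by push_cast; ring]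
    simp only [one_pow, mul_one, one_mul]
    rw [← h]
    refine Finset.sum_congr rfl fun n _ => ?_
    rw [zonalPoly_self hy, div_mul_cancel₀ _ (gegenbauer_one_pos ha _).ne']

end Expansion

/-! ### Normalization: from unit y to arbitrary y, and from `wellPoisedTerm` to `thetaCoeff`. -/

section Coefficients

variable {m : ℕ}

/-- If c = 0 or x = 0, then `cosAngle` divides by zero, but its value is irrelevant: C_0 is
constant, and for n > 0 the norm factors vanish. -/
theorem zonalHarmonic_smul {y : EuclideanSpace ℝ (Fin m)} (hy : ‖y‖ = 1) {c : ℝ} (hc : 0 ≤ c)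
    (n : ℕ) (x : EuclideanSpace ℝ (Fin m)) :
    zonalHarmonic m (2 * n) x (c • y)
      = (4 * n + m - 2) / (m - 2) * (c ^ (2 * n) * zonalPoly y n x) := by
  have hcy : ‖c • y‖ = c := by rw [norm_smul, hy, mul_one, Real.norm_of_nonneg hc]
  have key : ‖x‖ ^ (2 * n) * c ^ (2 * n) * gegenbauer ((m : ℝ) / 2 - 1) (2 * n)
      (cosAngle x (c • y)) = c ^ (2 * n) * zonalPoly y n x := by
    rcases hc.eq_or_lt with h0 | h0
    · subst h0
      rcases n with _ | n
      · simp [gegenbauer, zonalPoly, gegenbauerCoeff, zonalMonomial]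
      · rw [zero_pow (by omega)]
        ring
    rw [mul_comm (‖x‖ ^ _), mul_assoc]
    congr 1
    rw [gegenbauer_eq_sum (M := n + 1) _ (by omega), zonalPoly, Finset.mul_sum]
    refine Finset.sum_congr rfl fun i hi => ?_
    rw [Finset.mem_range] at hi
    rw [cosAngle, zonalMonomial, hcy, inner_smul_right, ← Nat.mul_sub]
    rcases eq_or_ne x 0 with rfl | hx
    · rcases i with _ | i
      · rcases n with _ | n
        · simp
        · simp
      · rw [norm_zero, zero_pow (by omega), zero_pow (n := 2) (by omega), zero_pow (by omega)]
        ring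
    · have hx' : ‖x‖ ≠ 0 := norm_ne_zero_iff.2 hx
      have h1 : c * inner ℝ x y / (‖x‖ * c) = inner ℝ x y / ‖x‖ := by field_simp
      have h2 : 2 * n = 2 * (n - i) + 2 * i := by omega
      rw [h1, div_pow]
      nth_rw 1 [h2]
      rw [pow_add, ← pow_mul]
      field_simp
  rw [zonalHarmonic, hcy, ← key]
  push_cast
  ring

theorem Gamma_add_nat {x : ℝ} (hx : 0 < x) (n : ℕ) :
    Real.Gamma (x + n) = (ascPochhammer ℝ n).eval x * Real.Gamma x := by
  induction n with
  | zero => simp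
  | succ n ih =>
    rw [show x + (n + 1 : ℕ) = x + n + 1 by push_cast; ring, Real.Gamma_add_one (by positivity), ih,
      ascPochhammer_succ_eval]
    ring

/-- The Pochhammer symbol in C_(2n)(1) = (2a)_(2n)/(2n)!, where a = m/2 - 1, is absorbed by Γ(2a +
2n) = (2a)_(2n) Γ(2a). -/
theorem thetaCoeff_eq (hm : 3 ≤ m) {k n : ℕ} (hn : n ≤ k) :
    thetaCoeff m (k - n) k k * ((4 * n + m - 2) / (m - 2))
      = wellPoisedTerm ((m : ℝ) / 2 - 1) k k n / gegenbauer ((m : ℝ) / 2 - 1) (2 * n) 1 := by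
  obtain ⟨a, ha0, hma⟩ : ∃ a : ℝ, 0 < a ∧ (m : ℝ) = 2 * a + 2 := by
    have : (3 : ℝ) ≤ m := by exact_mod_cast hm
    exact ⟨(m : ℝ) / 2 - 1, by linarith, by ring⟩
  have ha2 : (m : ℝ) / 2 - 1 = a := by rw [hma]; ring
  have hfac : (k.choose n : ℝ) * n.factorial * (k - n).factorial = k.factorial := by
    exact_mod_cast Nat.choose_mul_factorial_mul_factorial hn
  rw [thetaCoeff, wellPoisedTerm, gegenbauer_one, ha2, Nat.cast_sub hn,
    show k + k - 2 * (k - n) = 2 * n by omega, show k - (k - n) = n by omega, hma,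
    show 2 * a + 2 - 1 = 2 * a + 1 by ring, show 2 * a + 2 - 2 = 2 * a by ring,
    show (2 * a + 2) / 2 + (k : ℝ) - (k - n) - 1 = a + n by ring,
    show (2 * a + 2) / 2 + (k : ℝ) + k - (k - n) = a + 1 + k + n by ring,
    show 2 * a + 2 + (k : ℝ) + k - 2 * (k - n) - 2 = 2 * a + (2 * n : ℕ) by push_cast; ring,
    Gamma_add_nat (by positivity : 0 < 2 * a), Real.Gamma_add_one (by positivity), ← two_mul k,
    pow_mul, neg_one_sq, one_pow, ← hfac]
  have h1 := (ascPochhammer_pos (2 * n) (2 * a) (by positivity)).ne'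
  have h2 := (Real.Gamma_pos_of_pos (by positivity : 0 < 2 * a)).ne'
  have h3 := (Real.Gamma_pos_of_pos (by positivity : 0 < a + 1 + k + n)).ne'
  have h5 : (k.choose n : ℝ) ≠ 0 := by exact_mod_cast (Nat.choose_pos hn).ne'
  field_simp
  ring

theorem stiefelMean_eq_sum_zonalHarmonic (hm : 3 ≤ m) (k : ℕ) (x y : EuclideanSpace ℝ (Fin m)) :
    stiefelMean (planeForm x x ^ k * planeForm y y ^ k) = ∑ j ∈ Finset.range (k + 1),
      thetaCoeff m j k k * ‖x‖ ^ (2 * j) * zonalHarmonic m (2 * k - 2 * j) x y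
        * ‖y‖ ^ (2 * j) := by
  obtain ⟨z, hz, hyz⟩ : ∃ z : EuclideanSpace ℝ (Fin m), ‖z‖ = 1 ∧ y = ‖y‖ • z := by
    rcases eq_or_ne y 0 with rfl | hy
    · obtain ⟨z, hz, -⟩ := exists_unit_orthogonal (by omega : 2 ≤ m) 0
      exact ⟨z, hz, by simp⟩
    · refine ⟨‖y‖⁻¹ • y, norm_smul_inv_norm hy, ?_⟩
      rw [smul_inv_smul₀ (norm_ne_zero_iff.2 hy)]
  have hpl : planeForm y y = ‖y‖ ^ 2 • planeForm z z := by rw [← planeForm_smul, ← hyz]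
  rw [hpl, smul_pow, mul_smul_comm, map_smul, stiefelMean_eq_sum_zonalPoly hm hz, smul_eq_mul,
    Finset.mul_sum, ← Finset.sum_range_reflect]
  refine Finset.sum_congr rfl fun j hj => ?_
  rw [Finset.mem_range] at hj
  obtain ⟨n, rfl⟩ : ∃ n, k = j + n := ⟨k - j, by omega⟩
  rw [show j + n + 1 - 1 - j = n by omega, show 2 * (j + n) - 2 * j = 2 * n by omega,
    ← thetaCoeff_eq hm (by omega), show j + n - n = j by omega]
  have hK := zonalHarmonic_smul hz (norm_nonneg y) n x
  rw [← hyz] at hK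
  rw [hK]
  ring

end Coefficients

/-! ### From the dual Radon transform to the real mean. -/

section DualRadon

variable {m : ℕ} {V : Type*} [AddCommGroup V] [Module ℂ V]

/-- The part bilinear in (t, s) is odd in s, so against an even weight its inner integral vanishes.
A finite sum over coordinates makes every linear functional of the integrand continuous, although V
carries no topology. -/
theorem hasDualRadon_of_even {φ : C(EuclideanSpace ℝ (Fin m) × EuclideanSpace ℝ (Fin m), ℝ)}
    (hφ : ∀ t s, φ (t, -s) = φ (t, s)) {F : (Fin m → ℂ) → V} {v : V} {w : Fin m → Fin m → V}
    (hF : ∀ t s, F (tauVec t s) = (φ (t, ((s : perp t) : EuclideanSpace ℝ (Fin m))) : ℂ) •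
      (v + ∑ i, ∑ j, (((t : EuclideanSpace ℝ (Fin m)) i *
        ((s : perp t) : EuclideanSpace ℝ (Fin m)) j : ℝ) : ℂ) • w i j)) :
    HasDualRadon F ((stiefelMean φ : ℂ) • v) := by
  refine ⟨fun t => (innerIntegral φ t : ℂ) • v,
    ((∫ t, innerIntegral φ t ∂surfaceMeasure (EuclideanSpace ℝ (Fin m)) : ℝ) : ℂ) • v,
    fun t ψ => ?_, fun ψ => ?_, ?_⟩
  · set S := fun s : UnitSphere (perp t) => ((s : perp t) : EuclideanSpace ℝ (Fin m)) with hS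
    have hSc : Continuous S := continuous_coe_perp t
    have hφc : Continuous fun s => φ (t, S s) := φ.continuous.comp (continuous_const.prodMk hSc)
    set h : UnitSphere (perp t) → ℂ := fun s => (φ (t, S s) : ℂ) * ∑ i, ∑ j,
      (((t : EuclideanSpace ℝ (Fin m)) i * S s j : ℝ) : ℂ) * ψ (w i j) with hh
    have hhc : Continuous h := by
      have : ∀ j, Continuous fun s => S s j := fun j => by fun_prop
      fun_prop
    have hψ : (fun s => ψ (F (tauVec t s))) = fun s => (φ (t, S s) : ℂ) * ψ v + h s := by
      funext s
      rw [hF]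
      simp only [hh, map_smul, map_add, map_sum, smul_eq_mul, mul_add]
      rfl
    have hi1 : Integrable (fun s => (φ (t, S s) : ℂ) * ψ v) (surfaceMeasure (perp t)) :=
      integrable_of_continuous_sphere (by fun_prop)
    have hi2 : Integrable h (surfaceMeasure (perp t)) := integrable_of_continuous_sphere hhc
    have h0 : ∫ s, h s ∂surfaceMeasure (perp t) = 0 := by
      -- The antipodal map preserves the surface measure and changes the sign of `h`.
      have h1 := integral_sphereMap (LinearIsometryEquiv.neg ℝ (E := perp t)) hhc
      have h2 : (fun s => h (sphereMap (LinearIsometryEquiv.neg ℝ) s)) = fun s => -h s := by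
        funext s
        have hneg : S (sphereMap (LinearIsometryEquiv.neg ℝ) s) = -S s := rfl
        simp only [hh, hneg, hφ, PiLp.neg_apply, mul_neg, Complex.ofReal_neg, neg_mul,
          Finset.sum_neg_distrib]
      rw [h2, integral_neg] at h1
      exact self_eq_neg.1 h1.symm
    rw [hψ]
    refine ⟨hi1.add hi2, ?_⟩
    rw [integral_add hi1 hi2, h0, add_zero, integral_mul_const, integral_complex_ofReal, map_smul,
      smul_eq_mul]
    rfl
  · simp only [map_smul, smul_eq_mul]
    refine ⟨Integrable.mul_const (Integrable.ofReal
      (integrable_of_continuous_sphere (continuous_innerIntegral φ))) _, ?_⟩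
    rw [integral_mul_const, integral_complex_ofReal]
  · rw [smul_smul, ← Complex.ofReal_mul, stiefelMean_apply]

/-- With p = ⟨x, t⟩ and q = ⟨x, s⟩ the factors are p + iq and -p + iq. -/
theorem scalarProd_tauVec (x : EuclideanSpace ℝ (Fin m))
    (t : UnitSphere (EuclideanSpace ℝ (Fin m))) (s : UnitSphere (perp t)) :
    scalarProd (complexCoord x) (tauVec t s) * scalarProd (complexCoord x) (daggerVec (tauVec t s))
      = -(planeForm x x (t, ((s : perp t) : EuclideanSpace ℝ (Fin m))) : ℂ) := by
  have h (v : EuclideanSpace ℝ (Fin m)) : ∑ j, (x j : ℂ) * (v j : ℂ) = (inner ℝ x v : ℝ) := by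
    rw [PiLp.inner_apply]
    push_cast
    refine Finset.sum_congr rfl fun j _ => ?_
    simp [mul_comm]
  have h1 : scalarProd (complexCoord x) (tauVec t s)
      = (inner ℝ x (t : EuclideanSpace ℝ (Fin m)) : ℝ)
        + Complex.I * (inner ℝ x ((s : perp t) : EuclideanSpace ℝ (Fin m)) : ℝ) := by
    rw [← h, ← h, Finset.mul_sum, ← Finset.sum_add_distrib]
    refine Finset.sum_congr rfl fun j _ => ?_
    simp [tauVec, complexCoord]
    ring
  have h2 : scalarProd (complexCoord x) (daggerVec (tauVec t s))
      = -(inner ℝ x (t : EuclideanSpace ℝ (Fin m)) : ℝ)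
        + Complex.I * (inner ℝ x ((s : perp t) : EuclideanSpace ℝ (Fin m)) : ℝ) := by
    rw [← h, ← h, Finset.mul_sum, ← Finset.sum_neg_distrib, ← Finset.sum_add_distrib]
    refine Finset.sum_congr rfl fun j _ => ?_
    simp [tauVec, daggerVec, complexCoord]
    ring
  rw [h1, h2, planeForm_apply]
  push_cast
  linear_combination ((inner ℝ x ((s : perp t) : EuclideanSpace ℝ (Fin m)) : ℝ) : ℂ) ^ 2
    * Complex.I_sq

theorem scalarProd_pow_tauVec (x y : EuclideanSpace ℝ (Fin m)) (k : ℕ)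
    (t : UnitSphere (EuclideanSpace ℝ (Fin m))) (s : UnitSphere (perp t)) :
    scalarProd (complexCoord x) (tauVec t s) ^ k
        * scalarProd (complexCoord x) (daggerVec (tauVec t s)) ^ k
        * scalarProd (complexCoord y) (tauVec t s) ^ k
        * scalarProd (complexCoord y) (daggerVec (tauVec t s)) ^ k
      = ((planeForm x x ^ k * planeForm y y ^ k)
          (t, ((s : perp t) : EuclideanSpace ℝ (Fin m))) : ℂ) := by
  rw [mul_assoc, ← mul_pow, ← mul_pow, scalarProd_tauVec, scalarProd_tauVec, ← mul_pow, neg_mul_neg,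
    mul_pow]
  simp

theorem planeForm_neg (x y t s : EuclideanSpace ℝ (Fin m)) :
    planeForm x y (t, -s) = planeForm x y (t, s) := by
  simp [planeForm_apply]

end DualRadon

/-! ### The Clifford-valued mean -/

section Clifford

variable {m : ℕ}

theorem vecVar_mul_add_mul (x y : EuclideanSpace ℝ (Fin m)) :
    vecVar x * vecVar y + vecVar y * vecVar x
      = (-2 * (inner ℝ x y : ℝ) : ℂ) • (1 : ComplexClifford m) := by
  rw [vecVar, vecVar, scalarProd_eq]
  congr 2
  rw [scalarProd, PiLp.inner_apply]
  push_cast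
  refine Finset.sum_congr rfl fun j _ => ?_
  simp [complexCoord, mul_comm]

theorem vecVar_mul_self (x : EuclideanSpace ℝ (Fin m)) :
    vecVar x * vecVar x = (-‖x‖ ^ 2) • (1 : ComplexClifford m) := by
  have h := vecVar_mul_add_mul x x
  rw [real_inner_self_eq_norm_sq, ← two_smul ℂ (vecVar x * vecVar x)] at h
  have h2 := congrArg (fun z => (2⁻¹ : ℂ) • z) h
  simp only [smul_smul] at h2
  rw [inv_mul_cancel₀ two_ne_zero, one_smul] at h2
  rw [h2, ← algebraMap_smul ℂ (-‖x‖ ^ 2)]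
  congr 1
  simp

/-- Since t² = s² = -1 and st = -ts, the product (-t + is)(t + is) is 2 - 2i ts. The term ts is
expanded in coordinates to fit `hasDualRadon_of_even`. -/
theorem hermConj_mul_tauVec (t : UnitSphere (EuclideanSpace ℝ (Fin m))) (s : UnitSphere (perp t)) :
    hermConj (oneVector (tauVec t s)) * oneVector (tauVec t s)
      = (2 : ℂ) • (1 : ComplexClifford m) + ∑ i, ∑ j, (((t : EuclideanSpace ℝ (Fin m)) i *
        ((s : perp t) : EuclideanSpace ℝ (Fin m)) j : ℝ) : ℂ) •
          ((-2 * Complex.I) • (cliffordE i * cliffordE j : ComplexClifford m)) := by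
  set T := vecVar (t : EuclideanSpace ℝ (Fin m)) with hT
  set S := vecVar ((s : perp t) : EuclideanSpace ℝ (Fin m)) with hS
  have h1 : oneVector (tauVec t s) = T + Complex.I • S := by
    simp only [hT, hS, vecVar, oneVector, tauVec, Pi.add_apply, Pi.smul_apply, smul_eq_mul,
      add_smul, mul_smul, Finset.sum_add_distrib, Finset.smul_sum]
  have h2 : oneVector (daggerVec (tauVec t s)) = (-1 : ℂ) • T + Complex.I • S := by
    simp only [hT, hS, vecVar, oneVector, Finset.smul_sum, ← Finset.sum_add_distrib, smul_smul,
      ← add_smul]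
    refine Finset.sum_congr rfl fun j _ => ?_
    congr 1
    simp [daggerVec, tauVec, complexCoord]
    ring
  have hTT : T * T = (-1 : ℂ) • 1 := by
    rw [hT, vecVar_mul_self]; simp
  have hSS : S * S = (-1 : ℂ) • 1 := by
    have hs : ‖((s : perp t) : EuclideanSpace ℝ (Fin m))‖ = 1 := norm_eq_of_mem_sphere s
    rw [hS, vecVar_mul_self, hs]; simp
  have hST : S * T = (-1 : ℂ) • (T * S) := by
    have h := vecVar_mul_add_mul (t : EuclideanSpace ℝ (Fin m))
      ((s : perp t) : EuclideanSpace ℝ (Fin m))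
    rw [mem_perp_iff.1 (s : perp t).2] at h
    rw [neg_one_smul, eq_neg_iff_add_eq_zero, add_comm, hT, hS, h]
    simp
  have hsum : ∑ i, ∑ j, (((t : EuclideanSpace ℝ (Fin m)) i *
        ((s : perp t) : EuclideanSpace ℝ (Fin m)) j : ℝ) : ℂ) •
          ((-2 * Complex.I) • (cliffordE i * cliffordE j : ComplexClifford m))
      = (-2 * Complex.I) • (T * S) := by
    simp only [hT, hS, vecVar, oneVector, Finset.sum_mul_sum, Finset.smul_sum]
    refine Finset.sum_congr rfl fun i _ => Finset.sum_congr rfl fun j _ => ?_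
    rw [smul_mul_smul_comm, smul_comm]
    simp [complexCoord]
  rw [hsum, hermConj_oneVector, h2, h1]
  simp only [add_mul, mul_add, smul_mul_assoc, mul_smul_comm, hTT, hST, hSS, smul_smul]
  match_scalars
  · linear_combination -Complex.I_sq
  · ring

/-- The terms with xy cancel, and x(xy)y = |x|²|y|² leaves the difference of C_(n+2) and C_n with
parameter m/2, to which `gegenbauer_add_one_sub` applies. -/
theorem zonalMonogenic_sub (hm : 3 ≤ m) (n : ℕ) (x y : EuclideanSpace ℝ (Fin m)) :
    zonalMonogenic m (n + 2) x y - vecVar x * zonalMonogenic m (n + 1) x y * vecVar y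
      = zonalHarmonic m (n + 2) x y • (1 : ComplexClifford m) := by
  have hm' : (3 : ℝ) ≤ m := by exact_mod_cast hm
  have hg := gegenbauer_add_one_sub ((m : ℝ) / 2 - 1) (by linarith) n (cosAngle x y)
  rw [sub_add_cancel] at hg
  rw [zonalMonogenic, zonalMonogenic, zonalHarmonic, if_neg (by omega), if_neg (by omega),
    show n + 2 - 1 = n + 1 by omega, show n + 1 - 1 = n by omega]
  by_cases hr : ‖x‖ * ‖y‖ = 0
  · rw [hr, zero_pow (by omega), zero_pow (by omega), mul_assoc ((_ : ℝ) / _), ← mul_pow, hr,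
      zero_pow (by omega)]
    simp
  · have hxy : vecVar x * (vecVar x * vecVar y) * vecVar y
        = (‖x‖ * ‖y‖) ^ 2 • (1 : ComplexClifford m) := by
      rw [← mul_assoc, vecVar_mul_self, smul_mul_assoc, one_mul, smul_mul_assoc, vecVar_mul_self,
        smul_smul]
      congr 1
      ring
    have hK : (2 * (n + 2 : ℕ) + (m : ℝ) - 2) / (m - 2) * ‖x‖ ^ (n + 2) * ‖y‖ ^ (n + 2) *
        gegenbauer ((m : ℝ) / 2 - 1) (n + 2) (cosAngle x y) = (‖x‖ * ‖y‖) ^ (n + 2) *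
          (gegenbauer ((m : ℝ) / 2) (n + 2) (cosAngle x y)
            - gegenbauer ((m : ℝ) / 2) n (cosAngle x y)) := by
      rw [← hg]
      have h1 : (m : ℝ) - 2 ≠ 0 := by linarith
      have h2 : (m : ℝ) / 2 - 1 ≠ 0 := by linarith
      push_cast
      field_simp
      ring
    rw [hK]
    simp only [mul_smul_comm, smul_mul_assoc, mul_add, add_mul, mul_one, hxy, smul_add, smul_smul]
    generalize gegenbauer ((m : ℝ) / 2) (n + 1) (cosAngle x y) = g₁
    generalize gegenbauer ((m : ℝ) / 2) n (cosAngle x y) = g₀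
    generalize ‖x‖ * ‖y‖ = r at *
    have e1 : r ^ (n + 2) * (g₁ / r) = r ^ (n + 1) * g₁ := by field_simp; ring
    have e2 : r ^ (n + 1) * (g₀ / r) * r ^ 2 = r ^ (n + 2) * g₀ := by field_simp; ring
    rw [e1, e2]
    module

theorem vecVar_pow_two_mul (x : EuclideanSpace ℝ (Fin m)) (j : ℕ) :
    vecVar x ^ (2 * j) = (-‖x‖ ^ 2) ^ j • (1 : ComplexClifford m) := by
  rw [pow_mul, pow_two, vecVar_mul_self, smul_pow, one_pow]

theorem sum_range_two_mul_add_one {M : Type*} [AddCommMonoid M] (f : ℕ → M) (k : ℕ) :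
    ∑ i ∈ Finset.range (2 * k + 1), f i
      = ∑ j ∈ Finset.range k, (f (2 * j) + f (2 * j + 1)) + f (2 * k) := by
  induction k with
  | zero => simp
  | succ k ih =>
    rw [show 2 * (k + 1) + 1 = 2 * k + 1 + 1 + 1 by ring, Finset.sum_range_succ,
      Finset.sum_range_succ, ih, Finset.sum_range_succ _ k, add_assoc, add_assoc, add_assoc,
      add_assoc]
    rfl

/-- The coefficients of the expansion of the Clifford-valued mean. -/
def monogenicCoeff (m k i : ℕ) : ℝ :=
  if Even i then 2 * thetaCoeff m (i / 2) k k else -(2 * thetaCoeff m (i / 2) k k)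

theorem monogenicCoeff_two_mul (m k j : ℕ) : monogenicCoeff m k (2 * j) = 2 * thetaCoeff m j k k := by
  rw [monogenicCoeff, if_pos (even_two_mul j), show 2 * j / 2 = j by omega]

theorem monogenicCoeff_two_mul_add_one (m k j : ℕ) :
    monogenicCoeff m k (2 * j + 1) = -(2 * thetaCoeff m j k k) := by
  rw [monogenicCoeff, if_neg (by simp [parity_simps]), show (2 * j + 1) / 2 = j by omega]

/-- The terms 2j and 2j + 1 combine by `zonalMonogenic_sub`, and the signs of x^(2j) and y^(2j)
cancel. The last term 2k stands alone because C_(m,0) = K_(m,0) = 1. -/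
theorem sum_monogenicCoeff (hm : 3 ≤ m) (k : ℕ) (x y : EuclideanSpace ℝ (Fin m)) :
    ∑ i ∈ Finset.range (2 * k + 1), monogenicCoeff m k i •
        (vecVar x ^ i * zonalMonogenic m (2 * k - i) x y * vecVar y ^ i)
      = (2 * ∑ j ∈ Finset.range (k + 1), thetaCoeff m j k k * ‖x‖ ^ (2 * j)
          * zonalHarmonic m (2 * k - 2 * j) x y * ‖y‖ ^ (2 * j)) • (1 : ComplexClifford m) := by
  have hpow (j : ℕ) (A : ComplexClifford m) : vecVar x ^ (2 * j) * A * vecVar y ^ (2 * j)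
      = (‖x‖ ^ (2 * j) * ‖y‖ ^ (2 * j)) • A := by
    rw [vecVar_pow_two_mul, vecVar_pow_two_mul, smul_mul_assoc, one_mul, mul_smul_comm, mul_one,
      smul_smul, ← mul_pow, pow_mul, pow_mul, ← mul_pow]
    congr 2
    ring
  rw [sum_range_two_mul_add_one, Finset.mul_sum, Finset.sum_smul, Finset.sum_range_succ]
  congr 1
  · refine Finset.sum_congr rfl fun j hj => ?_
    rw [Finset.mem_range] at hj
    obtain ⟨n, hn⟩ : ∃ n, 2 * k - 2 * j = n + 2 := ⟨2 * k - 2 * j - 2, by omega⟩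
    have h1 : vecVar x ^ (2 * j + 1) * zonalMonogenic m (n + 1) x y * vecVar y ^ (2 * j + 1)
        = vecVar x ^ (2 * j) * (vecVar x * zonalMonogenic m (n + 1) x y * vecVar y)
          * vecVar y ^ (2 * j) := by
      rw [pow_succ, pow_succ']
      simp only [mul_assoc]
    rw [monogenicCoeff_two_mul, monogenicCoeff_two_mul_add_one, hn,
      show 2 * k - (2 * j + 1) = n + 1 by omega, h1, hpow, hpow, neg_smul, ← sub_eq_add_neg,
      ← smul_sub, ← smul_sub, zonalMonogenic_sub hm, smul_smul, smul_smul]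
    congr 1
    ring
  · rw [monogenicCoeff_two_mul, hpow, Nat.sub_self]
    simp [zonalMonogenic, zonalHarmonic, gegenbauer, smul_smul]
    have h2 : (m : ℝ) - 2 ≠ 0 := by
      have : (3 : ℝ) ≤ m := by exact_mod_cast hm
      linarith
    rw [div_self h2]
    ring

end Clifford
end

theorem mainTheorem9 (m k : ℕ) (hm : 3 ≤ m) :
    (∀ x y : EuclideanSpace ℝ (Fin m),
      HasDualRadon
        (fun τ : Fin m → ℂ =>
          scalarProd (complexCoord x) τ ^ k * scalarProd (complexCoord x) (daggerVec τ) ^ k *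
            scalarProd (complexCoord y) τ ^ k * scalarProd (complexCoord y) (daggerVec τ) ^ k)
        ((∑ j ∈ Finset.range (k + 1),
          thetaCoeff m j k k * ‖x‖ ^ (2 * j) * zonalHarmonic m (2 * k - 2 * j) x y
            * ‖y‖ ^ (2 * j) : ℝ) : ℂ)) ∧
    ∃ ϑ : ℕ → ℝ,
      (∀ x y : EuclideanSpace ℝ (Fin m),
        HasDualRadon
          (fun τ : Fin m → ℂ =>
            (scalarProd (complexCoord x) τ ^ k * scalarProd (complexCoord x) (daggerVec τ) ^ k *
              scalarProd (complexCoord y) τ ^ k * scalarProd (complexCoord y) (daggerVec τ) ^ k) •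
              (hermConj (oneVector τ) * oneVector τ))
          (∑ j ∈ Finset.range (2 * k + 1),
            ϑ j • (vecVar x ^ j * zonalMonogenic m (2 * k - j) x y * vecVar y ^ j))) ∧
      (∀ j ≤ k,
        ϑ (2 * j) = 2 * thetaCoeff m j k k ∧
        ϑ (2 * j) =
          ((m : ℝ) - 2) * (k.factorial : ℝ) ^ 4 * ((2 * k - 2 * j).factorial : ℝ)
              * Real.Gamma ((m : ℝ) - 1) * Real.Gamma ((m : ℝ) / 2 + k - j - 1) ^ 2
            / (2 * ((k - j).factorial : ℝ) ^ 2 * (j.factorial : ℝ) ^ 2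
              * Real.Gamma ((m : ℝ) / 2 + 2 * k - j) ^ 2
              * Real.Gamma (2 * (k : ℝ) - 2 * j + m - 2)) ∧
        ϑ (2 * j + 1) = -ϑ (2 * j)) := by
  have heven (x y t s : EuclideanSpace ℝ (Fin m)) :
      (planeForm x x ^ k * planeForm y y ^ k) (t, -s)
        = (planeForm x x ^ k * planeForm y y ^ k) (t, s) := by
    simp [planeForm_neg]
  refine ⟨fun x y => ?_, monogenicCoeff m k, fun x y => ?_, fun j hj => ⟨?_, ?_, ?_⟩⟩
  · rw [← stiefelMean_eq_sum_zonalHarmonic hm]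
    have h := hasDualRadon_of_even (V := ℂ) (heven x y) (v := 1) (w := fun _ _ => 0)
      (F := fun τ : Fin m → ℂ =>
          scalarProd (complexCoord x) τ ^ k * scalarProd (complexCoord x) (daggerVec τ) ^ k *
            scalarProd (complexCoord y) τ ^ k * scalarProd (complexCoord y) (daggerVec τ) ^ k)
      (fun t s => by simp [scalarProd_pow_tauVec])
    rwa [smul_eq_mul, mul_one] at h
  · rw [sum_monogenicCoeff hm, ← stiefelMean_eq_sum_zonalHarmonic hm]
    have h := hasDualRadon_of_even (heven x y) (F := fun τ : Fin m → ℂ =>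
            (scalarProd (complexCoord x) τ ^ k * scalarProd (complexCoord x) (daggerVec τ) ^ k *
              scalarProd (complexCoord y) τ ^ k * scalarProd (complexCoord y) (daggerVec τ) ^ k) •
              (hermConj (oneVector τ) * oneVector τ))
      (fun t s => by rw [scalarProd_pow_tauVec, hermConj_mul_tauVec])
    convert h using 1
    rw [smul_smul, ← algebraMap_smul ℂ]
    congr 1
    simp [mul_comm]
  · exact monogenicCoeff_two_mul m k j
  · rw [monogenicCoeff_two_mul, thetaCoeff, ← two_mul k, pow_mul, neg_one_sq, one_pow,
      show (m : ℝ) / 2 + 2 * k - j = (m : ℝ) / 2 + k + k - j by ring,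
      show 2 * (k : ℝ) - 2 * j + m - 2 = m + k + k - 2 * j - 2 by ring]
    field_simp
    ring
  -- For j = k the index 2k + 1 lies outside the expansion; `monogenicCoeff` merely continues the
  -- sign pattern there.
  · rw [monogenicCoeff_two_mul, monogenicCoeff_two_mul_add_one]
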